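/- A codimension $q$ foliation $\mathcal F$ of a smooth connected manifold $M^n$, $2\le q<n$, together with a transverse metric $g_\intercal$ of index $1$ (a smooth symmetric $(0,2)$-tensor that vanishes when one argument is tangent to $\mathcal F$, satisfies $\mathcal L_Vg_\intercal=0$ for all vector fields $V$ tangent to $\mathcal F$, and induces a nondegenerate form of index $1$ on the normal bundle $\nu(\mathcal F)=TM/T\mathcal F$) is called a Lorentzian foliation. It is time-orientable if one can choose at each $x\in M$, smoothly in $x$, a connected component of $\{v\in T_xM: g_\intercal(v,v)<0\}$. A Lorentzian metric $g$ on $M$ is bundle-like with associated transverse metric $g_\intercal$ if $TM=T\mathcal F\oplus T\mathcal F^{\perp}$ and $g_\intercal(v,w)=g(v^\perp,w^\perp)$, where $v^\perp,w^\perp$ are the components of $v,w$ in $T\mathcal F^{\perp}$. Let $\mathrm{Ric}_g$ be the Ricci tensor of $g$, and let $\mathrm{Ric}_\intercal(X,Y)=\sum_{i=1}^q\varepsilon_i\,\overline{g_\intercal}(R_\intercal(E_i,X)\overline Y,\overline E_i)$ be the transverse Ricci tensor, where an overline denotes the class in, or the form induced on, $\nu(\mathcal F)$, $R_\intercal(X,Y)=[\nabla^\intercal_X,\nabla^\intercal_Y]-\nabla^\intercal_{[X,Y]}$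 is the curvature of the unique connection $\nabla^\intercal$ on $\nu(\mathcal F)$ that is compatible with $\overline{g_\intercal}$ and torsion-free ($\nabla^\intercal_X\overline Y-\nabla^\intercal_Y\overline X=\overline{[X,Y]}$), $(\overline E_i)$ is an orthonormal frame of $\nu(\mathcal F)$, and $\varepsilon_i=\overline{g_\intercal}(\overline E_i,\overline E_i)$. **Proposition.** There exist time-orientable Lorentzian foliations $(M,\mathcal F,g_\intercal)$ with an associated Lorentzian bundle-like metric $g$ such that, respectively: 1. there are constants $A,C>0$ such that every $v\in TM$ with $g(v,v)=-1$ satisfies $\mathrm{Ric}_g(v,v)\ge C$ and $\mathrm{Ric}_\intercal(v,v)\le -A$; 2. there is a constant $C>0$ such that every $v\in TM$ with $g(v,v)=-1$ satisfies $\mathrm{Ric}_\intercal(v,v)\ge C$, but there is $v_0\in TM$ with $g(v_0,v_0)<0$ and $\mathrm{Ric}_g(v_0,v_0)<0$. In both cases the example can be taken to be a warped product: $M=B\times F$ with $g=\pi_B^*g_B+(f\circ\pi_B)^2\pi_F^*g_F$, where $(B,g_B)$ is a connected Lorentzian manifold of dimension $q\ge 2$, $(F,g_F)$ is a connected Riemannian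 manifold of dimension $p\ge 1$, $f\in C^\infty(B)$ is positive, and $\mathcal F$ is the foliation by the fibres $\{b\}\times F$. -/

import Mathlib

open Set Function Bundle Manifold Topology
open scoped Manifold ContDiff

noncomputable section

namespace LorentzFoliation

section General

/- `M` is a smooth manifold, modelled on a finite-dimensional real vector space through `I`. -/
variable {E : Type*} [NormedAddCommGroup E] [NormedSpace ℝ E] [FiniteDimensional ℝ E]
  {H : Type*} [TopologicalSpace H] (I : ModelWithCorners ℝ E H)
  {M : Type*} [TopologicalSpace M] [ChartedSpace H M] [IsManifold I ∞ M]

/-! ### Vector fields and covariant 2-tensors -/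

/-- The (not necessarily smooth) vector field `X` on `M` is smooth on the set `U`. -/
def SmoothFieldOn (X : ∀ x : M, TangentSpace I x) (U : Set M) : Prop :=
  ContMDiffOn I I.tangent ∞ (fun x => (⟨x, X x⟩ : TangentBundle I M)) U

/-- `X` is a smooth vector field on `M`. -/
def SmoothField (X : ∀ x : M, TangentSpace I x) : Prop :=
  ContMDiff I I.tangent ∞ (fun x => (⟨x, X x⟩ : TangentBundle I M))

/-- The real function `h` is differentiated along the vector field `X`: the function `X h`. -/
def dirDeriv (X : ∀ x : M, TangentSpace I x) (h : M → ℝ) (x : M) : ℝ :=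
  mfderiv I 𝓘(ℝ, ℝ) h x (X x)

variable {I}

/-- A pointwise given `(0,2)`-tensor `T` is smooth: it sends pairs of smooth vector fields to
smooth functions. -/
def SmoothTensor (T : ∀ x : M, LinearMap.BilinForm ℝ (TangentSpace I x)) : Prop :=
  ∀ X Y : ∀ x : M, TangentSpace I x, SmoothField I X → SmoothField I Y →
    ContMDiff I 𝓘(ℝ, ℝ) ∞ (fun x => T x (X x) (Y x))

/-- The index of a symmetric bilinear form: the maximal dimension of a subspace on which it is
negative definite. -/
def bilinIndex {V : Type*} [AddCommGroup V] [Module ℝ V] (b : LinearMap.BilinForm ℝ V) : ℕ :=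
  sigNeg (LinearMap.BilinMap.toQuadraticMap b)

/-- `g` is a (smooth) semi-Riemannian metric of index `μ` on `M`. It is Riemannian if `μ = 0`, and
Lorentzian if `μ = 1` and `dim M ≥ 2`. -/
structure IsSemiRiemannianMetric (g : ∀ x : M, LinearMap.BilinForm ℝ (TangentSpace I x))
    (μ : ℕ) : Prop where
  symm : ∀ x v w, g x v w = g x w v
  smooth : SmoothTensor g
  nondegenerate : ∀ x, (g x).Nondegenerate
  index : ∀ x, bilinIndex (g x) = μ

/-! ### Foliations -/

variable (I M) in
/-- A codimension `q` foliation of `M`, given by a Haefliger cocycle `(U i, proj i, trans i j)`: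
an open cover `U i` of `M`, submersions `proj i : U i → ℝ^q`, and transition maps
`trans i j : proj j (U i ∩ U j) → proj i (U i ∩ U j)` with `trans i j ∘ proj j = proj i`.
(The values of `proj i` outside `U i` are irrelevant. By `trans_proj`, the maps `trans i j` and
`trans j i` are inverse to each other, so each of them is a diffeomorphism.) -/
structure Foliation (q : ℕ) where
  ι : Type
  U : ι → Set M
  isOpen_U : ∀ i, IsOpen (U i)
  cover : ∀ x, ∃ i, x ∈ U i
  proj : ι → M → EuclideanSpace ℝ (Fin q)
  smooth_proj : ∀ i, ContMDiffOn I (𝓡 q) ∞ (proj i) (U i)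
  submersion : ∀ i, ∀ x ∈ U i, Surjective (mfderiv I (𝓡 q) (proj i) x)
  trans : ι → ι → EuclideanSpace ℝ (Fin q) → EuclideanSpace ℝ (Fin q)
  smooth_trans : ∀ i j, ContDiffOn ℝ ∞ (trans i j) (proj j '' (U i ∩ U j))
  trans_proj : ∀ i j, ∀ x ∈ U i ∩ U j, trans i j (proj j x) = proj i x

namespace Foliation

variable {q : ℕ} (𝓕 : Foliation I M q)

/-- The space tangent at `x` to the leaf through `x`. All submersions `proj i` with `x ∈ U i` have
the same kernel at `x`, and this is that kernel. -/
def tangent (x : M) : Submodule ℝ (TangentSpace I x) :=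
  ⨅ i, ⨅ _ : x ∈ 𝓕.U i, LinearMap.ker (mfderiv I (𝓡 q) (𝓕.proj i) x).toLinearMap

/-- The fibre at `x` of the normal bundle of the foliation. -/
abbrev Normal (x : M) : Type _ := TangentSpace I x ⧸ 𝓕.tangent x

/-- The class of a tangent vector in the normal bundle. -/
def toNormal (x : M) : TangentSpace I x →ₗ[ℝ] 𝓕.Normal x := (𝓕.tangent x).mkQ

/-- The `(0,2)`-tensor `T` is basic: it vanishes as soon as one argument is tangent to the leaves,
and its Lie derivative along every smooth vector field tangent to the leaves is zero. -/
structure IsBasic (T : ∀ x : M, LinearMap.BilinForm ℝ (TangentSpace I x)) : Prop where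
  left : ∀ x, 𝓕.tangent x ≤ LinearMap.ker (T x)
  right : ∀ x, 𝓕.tangent x ≤ LinearMap.ker (LinearMap.flip (T x))
  lie : ∀ V X Y : ∀ x : M, TangentSpace I x, SmoothField I V → SmoothField I X →
    SmoothField I Y → (∀ x, V x ∈ 𝓕.tangent x) → ∀ x,
      dirDeriv I V (fun y => T y (X y) (Y y)) x
        = T x (VectorField.mlieBracket I V X x) (Y x)
          + T x (X x) (VectorField.mlieBracket I V Y x)

variable {𝓕} in
/-- The bilinear form induced on the normal space at `x` by a basic `(0,2)`-tensor. -/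
def IsBasic.normalForm {T : ∀ x : M, LinearMap.BilinForm ℝ (TangentSpace I x)}
    (hT : 𝓕.IsBasic T) (x : M) : LinearMap.BilinForm ℝ (𝓕.Normal x) :=
  LinearMap.liftQ₂ (𝓕.tangent x) (𝓕.tangent x) (T x) (hT.left x) (hT.right x)

/-- A semi-Riemannian transverse metric of index `μ` for the foliation: a smooth symmetric basic
`(0,2)`-tensor inducing a nondegenerate form of index `μ` on each normal space. For
`μ = 1` and codimension at least `2`, the foliation with this metric is a Lorentzian foliation. -/
structure TransverseMetric (μ : ℕ) where
  form : ∀ x : M, LinearMap.BilinForm ℝ (TangentSpace I x)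
  symm : ∀ x v w, form x v w = form x w v
  smooth : SmoothTensor form
  basic : 𝓕.IsBasic form
  nondegenerate : ∀ x, (basic.normalForm x).Nondegenerate
  index : ∀ x, bilinIndex (basic.normalForm x) = μ

variable {𝓕}

/-- The metric `g` on `M` is bundle-like for the foliation, with associated transverse metric `gT`:
the spaces `T𝓕` and `T𝓕^⊥` are complementary, and `gT(v, w)` is the `g`-product of the
components of `v` and `w` in `T𝓕^⊥`. -/
structure IsBundleLike (g : ∀ x : M, LinearMap.BilinForm ℝ (TangentSpace I x)) {μ : ℕ}
    (gT : 𝓕.TransverseMetric μ) : Prop where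
  adapted : ∀ x, IsCompl (𝓕.tangent x) ((g x).orthogonal (𝓕.tangent x))
  associated : ∀ x, ∀ a ∈ 𝓕.tangent x, ∀ b ∈ 𝓕.tangent x,
    ∀ v ∈ (g x).orthogonal (𝓕.tangent x), ∀ w ∈ (g x).orthogonal (𝓕.tangent x),
      gT.form x (a + v) (b + w) = g x v w

/-- The transversely timelike vectors at `x`. -/
def TransverseMetric.timelike {μ : ℕ} (gT : 𝓕.TransverseMetric μ) (x : M) :
    Set (TangentSpace I x) :=
  {v | gT.form x v v < 0}

/-- A Lorentzian foliation is transversely time-orientable: one can choose at each point `x` a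
timewedge `𝒯 x` (a connected component of the set of transversely timelike vectors), in such a way
that near each point there is a smooth vector field with values in the chosen timewedges. -/
def TransverseMetric.TimeOrientable {μ : ℕ} (gT : 𝓕.TransverseMetric μ) : Prop :=
  ∃ 𝒯 : ∀ x : M, Set (TangentSpace I x),
    (∀ x, ∃ v ∈ gT.timelike x, 𝒯 x = connectedComponentIn (gT.timelike x) v) ∧
    ∀ x, ∃ U : Set M, IsOpen U ∧ x ∈ U ∧ ∃ X : ∀ y : M, TangentSpace I y,
      SmoothFieldOn I X U ∧ ∀ y ∈ U, X y ∈ 𝒯 y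

end Foliation

/-! ### Levi-Civita connections, curvature and Ricci tensors

`V` is either the tangent bundle (with `pr x` the identity) or the normal bundle of a foliation
(with `pr x` the quotient map), and `σ` is a metric on `V`. -/

variable {V : M → Type*} [∀ x, AddCommGroup (V x)] [∀ x, Module ℝ (V x)]

/-- A section of `V` is smooth if it is the image of a smooth vector field. -/
def SmoothSection (pr : ∀ x : M, TangentSpace I x →ₗ[ℝ] V x) (ξ : ∀ x, V x) : Prop :=
  ∃ Y : ∀ x : M, TangentSpace I x, SmoothField I Y ∧ ∀ x, ξ x = pr x (Y x)

/-- `D` is (on smooth arguments) a linear connection on `V`; `D X ξ` stands for `∇_X ξ`. The values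
of `D` on arguments that are not smooth are irrelevant. -/
structure IsConnection (pr : ∀ x : M, TangentSpace I x →ₗ[ℝ] V x)
    (D : (∀ x : M, TangentSpace I x) → (∀ x, V x) → ∀ x, V x) : Prop where
  smooth : ∀ X ξ, SmoothField I X → SmoothSection pr ξ → SmoothSection pr (D X ξ)
  add_left : ∀ X Y ξ, SmoothField I X → SmoothField I Y → SmoothSection pr ξ →
    D (X + Y) ξ = D X ξ + D Y ξ
  smul_left : ∀ (h : M → ℝ) X ξ, ContMDiff I 𝓘(ℝ, ℝ) ∞ h → SmoothField I X →
    SmoothSection pr ξ → D (fun x => h x • X x) ξ = fun x => h x • D X ξ x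
  add_right : ∀ X ξ η, SmoothField I X → SmoothSection pr ξ → SmoothSection pr η →
    D X (ξ + η) = D X ξ + D X η
  leibniz : ∀ (h : M → ℝ) X ξ, ContMDiff I 𝓘(ℝ, ℝ) ∞ h → SmoothField I X →
    SmoothSection pr ξ →
      D X (fun x => h x • ξ x) = fun x => h x • D X ξ x + dirDeriv I X h x • ξ x

/-- `D` is the Levi-Civita connection on `V`: a connection that is compatible with the metric `σ`
and torsion-free. (It is unique on smooth arguments.) -/
structure IsLeviCivita (pr : ∀ x : M, TangentSpace I x →ₗ[ℝ] V x)
    (σ : ∀ x, LinearMap.BilinForm ℝ (V x))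
    (D : (∀ x : M, TangentSpace I x) → (∀ x, V x) → ∀ x, V x) : Prop
    extends IsConnection pr D where
  metric : ∀ X ξ η, SmoothField I X → SmoothSection pr ξ → SmoothSection pr η → ∀ x,
    dirDeriv I X (fun y => σ y (ξ y) (η y)) x = σ x (D X ξ x) (η x) + σ x (ξ x) (D X η x)
  torsion_free : ∀ X Y, SmoothField I X → SmoothField I Y → ∀ x,
    D X (fun y => pr y (Y y)) x - D Y (fun y => pr y (X y)) x
      = pr x (VectorField.mlieBracket I X Y x)

/-- The curvature `R(X,Y)ξ = ∇_X ∇_Y ξ - ∇_Y ∇_X ξ - ∇_[X,Y] ξ`. -/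
def curvature (D : (∀ x : M, TangentSpace I x) → (∀ x, V x) → ∀ x, V x)
    (X Y : ∀ x : M, TangentSpace I x) (ξ : ∀ x, V x) : ∀ x, V x :=
  D X (D Y ξ) - D Y (D X ξ) - D (VectorField.mlieBracket I X Y) ξ

/-- `Ric` is the Ricci tensor of the metric `σ` on `V`:
`Ric(X, Y) = ∑ i, ε i * σ(R(e i, X) Y, e i)` for the curvature `R` of the Levi-Civita connection,
where the fields `e i` project to a `σ`-orthonormal basis of `V x` at the point `x` considered, and
`ε i = σ(e i, e i)`. (There is exactly one such tensor.) -/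
def IsRicci (pr : ∀ x : M, TangentSpace I x →ₗ[ℝ] V x)
    (σ : ∀ x, LinearMap.BilinForm ℝ (V x))
    (Ric : ∀ x : M, LinearMap.BilinForm ℝ (TangentSpace I x)) : Prop :=
  ∃ D : (∀ x : M, TangentSpace I x) → (∀ x, V x) → ∀ x, V x, IsLeviCivita pr σ D ∧
    ∀ (X Y : ∀ x : M, TangentSpace I x) (x : M)
      (e : Fin (Module.finrank ℝ (V x)) → ∀ y : M, TangentSpace I y)
      (ε : Fin (Module.finrank ℝ (V x)) → ℝ),
      SmoothField I X → SmoothField I Y → (∀ i, SmoothField I (e i)) →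
      (∀ i, ε i = 1 ∨ ε i = -1) →
      (∀ i j, σ x (pr x (e i x)) (pr x (e j x)) = if i = j then ε i else 0) →
      Ric x (X x) (Y x)
        = ∑ i, ε i * σ x (curvature D (e i) X (fun y => pr y (Y y)) x) (pr x (e i x))

/-- `Ric` is the Ricci tensor of the semi-Riemannian metric `g` on `M`. -/
def IsRicciTensor (g Ric : ∀ x : M, LinearMap.BilinForm ℝ (TangentSpace I x)) : Prop :=
  IsRicci (V := fun x : M => TangentSpace I x) (fun _ => LinearMap.id) g Ric

/-- `Ric` is the transverse Ricci tensor of the foliation with transverse metric `gT`. -/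
def Foliation.TransverseMetric.IsTransverseRicciTensor {q μ : ℕ} {𝓕 : Foliation I M q}
    (gT : 𝓕.TransverseMetric μ)
    (Ric : ∀ x : M, LinearMap.BilinForm ℝ (TangentSpace I x)) : Prop :=
  IsRicci (V := fun x : M => 𝓕.Normal x) 𝓕.toNormal gT.basic.normalForm Ric

end General

/-! ### Warped products -/

section Warped

variable {q p : ℕ}
  {B : Type} [TopologicalSpace B] [ChartedSpace (EuclideanSpace ℝ (Fin q)) B]
  [IsManifold (𝓡 q) ∞ B]
  {F : Type} [TopologicalSpace F] [ChartedSpace (EuclideanSpace ℝ (Fin p)) F]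
  [IsManifold (𝓡 p) ∞ F]

/-- The warped product metric `π_B^* gB + (f ∘ π_B)^2 π_F^* gF` on `B × F`. -/
def warpedMetric (gB : ∀ b : B, LinearMap.BilinForm ℝ (TangentSpace (𝓡 q) b)) (f : B → ℝ)
    (gF : ∀ y : F, LinearMap.BilinForm ℝ (TangentSpace (𝓡 p) y)) (z : B × F) :
    LinearMap.BilinForm ℝ (TangentSpace ((𝓡 q).prod (𝓡 p)) z) :=
  LinearMap.BilinForm.comp (gB z.1)
      (mfderiv ((𝓡 q).prod (𝓡 p)) (𝓡 q) Prod.fst z).toLinearMap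
      (mfderiv ((𝓡 q).prod (𝓡 p)) (𝓡 q) Prod.fst z).toLinearMap
    + (f z.1) ^ 2 • LinearMap.BilinForm.comp (gF z.2)
      (mfderiv ((𝓡 q).prod (𝓡 p)) (𝓡 p) Prod.snd z).toLinearMap
      (mfderiv ((𝓡 q).prod (𝓡 p)) (𝓡 p) Prod.snd z).toLinearMap

/-- The warped product `B ×_f F` of a Lorentzian manifold `B` of dimension `q ≥ 2` and a Riemannian
manifold `F` of dimension `p ≥ 1`, both connected, is given the foliation `𝓕` by the fibres
`{b} × F`. This is a time-orientable Lorentzian foliation with transverse metric `gT`,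
for which the Lorentzian metric of the warped product is bundle-like, with associated
transverse metric `gT`. -/
structure IsWarpedLorentzFoliation (gB : ∀ b : B, LinearMap.BilinForm ℝ (TangentSpace (𝓡 q) b))
    (f : B → ℝ) (gF : ∀ y : F, LinearMap.BilinForm ℝ (TangentSpace (𝓡 p) y))
    (𝓕 : Foliation ((𝓡 q).prod (𝓡 p)) (B × F) q) (gT : 𝓕.TransverseMetric 1) : Prop where
  two_le : 2 ≤ q
  one_le : 1 ≤ p
  t2_B : T2Space B
  secondCountable_B : SecondCountableTopology B
  connected_B : ConnectedSpace B
  t2_F : T2Space F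
  secondCountable_F : SecondCountableTopology F
  connected_F : ConnectedSpace F
  lorentzian_B : IsSemiRiemannianMetric gB 1
  riemannian_F : IsSemiRiemannianMetric gF 0
  smooth_f : ContMDiff (𝓡 q) 𝓘(ℝ, ℝ) ∞ f
  pos_f : ∀ b, 0 < f b
  tangent_eq : ∀ z, 𝓕.tangent z
    = LinearMap.ker (mfderiv ((𝓡 q).prod (𝓡 p)) (𝓡 q) (Prod.fst : B × F → B) z).toLinearMap
  lorentzian : IsSemiRiemannianMetric (warpedMetric gB f gF) 1
  bundleLike : Foliation.IsBundleLike (warpedMetric gB f gF) gT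
  timeOrientable : gT.TimeOrientable

end Warped

end LorentzFoliation

end

open LorentzFoliation

noncomputable section

namespace LorentzFoliation

section FlatModel

variable {E : Type*} [NormedAddCommGroup E] [NormedSpace ℝ E]

/-- The manifold structure on the vector space `E` is the standard one, up to propositional
equality of charts: smoothness, derivatives and Lie brackets are those of `E`. -/
structure IsFlatModel {H : Type*} [TopologicalSpace H] (I : ModelWithCorners ℝ E H)
    [ChartedSpace H E] [IsManifold I ∞ E] : Prop where
  smoothField_iff : ∀ {X : ∀ x : E, TangentSpace I x},
    SmoothField I X ↔ ContDiff ℝ ∞ (fun x => (X x : E))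
  contMDiff_iff : ∀ {h : E → ℝ}, ContMDiff I 𝓘(ℝ, ℝ) ∞ h ↔ ContDiff ℝ ∞ h
  dirDeriv_eq : ∀ (X : ∀ x : E, TangentSpace I x) (h : E → ℝ) (x : E),
    dirDeriv I X h x = fderiv ℝ h x (X x)
  mlieBracket_eq : ∀ (X Y : ∀ x : E, TangentSpace I x) (x : E),
    VectorField.mlieBracket I X Y x
      = (fderiv ℝ (fun x => (Y x : E)) x (X x) - fderiv ℝ (fun x => (X x : E)) x (Y x) : E)

theorem isFlatModel_of_eq {I : ModelWithCorners ℝ E E} {c : ChartedSpace E E}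
    {hM : IsManifold I ∞ E} (hI : I = 𝓘(ℝ, E)) (hc : c = chartedSpaceSelf E) : IsFlatModel I := by
  subst hI hc
  refine ⟨contMDiff_vectorSpace_iff_contDiff, contMDiff_iff_contDiff, fun X h x => ?_,
    fun X Y x => ?_⟩
  · simp only [dirDeriv, mfderiv_eq_fderiv]
    rfl
  · rw [← VectorField.mlieBracketWithin_univ, VectorField.mlieBracketWithin_eq_lieBracketWithin]
    exact congrFun VectorField.lieBracketWithin_univ x

theorem isFlatModel_self : IsFlatModel 𝓘(ℝ, E) := isFlatModel_of_eq rfl rfl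

theorem isFlatModel_prod {E' : Type*} [NormedAddCommGroup E'] [NormedSpace ℝ E'] :
    IsFlatModel (E := E × E') (𝓘(ℝ, E).prod 𝓘(ℝ, E')) :=
  isFlatModel_of_eq (E := E × E') (I := 𝓘(ℝ, E).prod 𝓘(ℝ, E')) (c := prodChartedSpace E E E' E')
    modelWithCornersSelf_prod.symm chartedSpaceSelf_prod

end FlatModel

section DiagonalForms

variable {κ : Type*} [Fintype κ] [DecidableEq κ] {V : Type*} [AddCommGroup V] [Module ℝ V]
  {b : LinearMap.BilinForm ℝ V} (Φ : V ≃ₗ[ℝ] (κ → ℝ)) (ε : κ → ℝ)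

theorem nondegenerate_of_diagonal (hε : ∀ i, ε i ≠ 0)
    (hb : ∀ v w, b v w = ∑ i, ε i * Φ v i * Φ w i) : b.Nondegenerate := by
  have hs : ∀ v w, b v w = b w v := fun v w => by
    rw [hb, hb]; exact Finset.sum_congr rfl fun i _ => by ring
  have key : ∀ v, (∀ w, b v w = 0) → v = 0 := by
    intro v hv
    refine Φ.injective (funext fun i => ?_)
    have h := hv (Φ.symm (Pi.single i 1))
    rw [hb] at h
    simpa [Pi.single_apply, hε i] using h
  exact ⟨key, fun v hv => key v fun w => by rw [hs]; exact hv w⟩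

omit [DecidableEq κ] in
theorem bilinIndex_of_diagonal (hb : ∀ v w, b v w = ∑ i, ε i * Φ v i * Φ w i) :
    bilinIndex b = {i | ε i < 0}.ncard := by
  refine QuadraticForm.sigNeg_of_equiv_weightedSumSquares
    ⟨⟨Φ, fun v => ?_⟩⟩
  simp only [QuadraticMap.weightedSumSquares_apply, LinearMap.BilinMap.toQuadraticMap_apply, hb]
  exact Finset.sum_congr rfl fun i _ => by simp; ring

/-- The inverse Gram relation of an orthonormal basis `u` of a diagonal form. -/
theorem sum_orthonormal_mul {ι : Type*} [Fintype ι] [DecidableEq ι]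
    (hcard : Fintype.card ι = Fintype.card κ) (hε : ∀ i, ε i = 1 ∨ ε i = -1)
    (ε' : ι → ℝ) (hε' : ∀ k, ε' k = 1 ∨ ε' k = -1) (u : ι → κ → ℝ)
    (hu : ∀ k l, ∑ i, ε i * u k i * u l i = if k = l then ε' k else 0) (i j : κ) :
    ∑ k, ε' k * u k i * u k j = if i = j then ε i else 0 := by
  have sq : ∀ i, ε i * ε i = 1 := fun i => by rcases hε i with h | h <;> simp [h]
  have sq' : ∀ i, ε' i * ε' i = 1 := fun i => by rcases hε' i with h | h <;> simp [h]
  let P : Matrix ι κ ℝ := Matrix.of fun k i => ε' k * u k i * ε i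
  let Q : Matrix κ ι ℝ := Matrix.of fun i k => u k i
  have h1 : P * Q = 1 := by
    ext k l
    have : (P * Q) k l = ε' k * ∑ i, ε i * u k i * u l i := by
      simp only [Matrix.mul_apply, P, Q, Matrix.of_apply, Finset.mul_sum]
      exact Finset.sum_congr rfl fun i _ => by ring
    rw [this, hu, Matrix.one_apply]
    split_ifs <;> simp [sq']
  have h2 := (Matrix.mul_eq_one_comm_of_card_eq _ _ _ hcard).1 h1
  have h3 := congrFun (congrFun h2 i) j
  have h4 : (Q * P) i j = (∑ k, ε' k * u k i * u k j) * ε j := by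
    simp only [Matrix.mul_apply, P, Q, Matrix.of_apply, Finset.sum_mul]
    exact Finset.sum_congr rfl fun i _ => by ring
  rw [h4, Matrix.one_apply] at h3
  have h5 : ∑ k, ε' k * u k i * u k j = (if i = j then 1 else 0) * ε j := by
    rw [← h3, mul_assoc, sq, mul_one]
  rw [h5]
  split_ifs with h <;> simp [h]

end DiagonalForms

section ConnectionForm

variable {κ : Type*} [Fintype κ] [DecidableEq κ] (a ε : κ → ℝ) (o : κ)

/-- The connection form of the metric `∑ i, ε i e^{2 a i r} dx_i²`, `r = x_o`, in the orthonormal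
frame `e^{-a i r} ∂_i`. -/
def connBilin : (κ → ℝ) →L[ℝ] (κ → ℝ) →L[ℝ] (κ → ℝ) :=
  LinearMap.toContinuousBilinearMap <| LinearMap.mk₂ ℝ
    (fun t w i => w o * (a i * t i) - (Pi.single o (∑ j, ε j * a j * t j * w j) : κ → ℝ) i)
    (fun t t' w => by
      ext i
      simp only [Pi.add_apply, mul_add, add_mul, Finset.sum_add_distrib, Pi.single_add]
      ring)
    (fun c t w => by
      have : ∑ j, ε j * a j * (c * t j) * w j = c * ∑ j, ε j * a j * t j * w j := by
        rw [Finset.mul_sum]; exact Finset.sum_congr rfl fun _ _ => by ring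
      ext i
      simp only [Pi.smul_apply, smul_eq_mul, this, Pi.single_apply]
      split_ifs <;> ring)
    (fun t w w' => by
      ext i
      simp only [Pi.add_apply, mul_add, add_mul, Finset.sum_add_distrib, Pi.single_add]
      ring)
    (fun c t w => by
      have : ∑ j, ε j * a j * t j * (c * w j) = c * ∑ j, ε j * a j * t j * w j := by
        rw [Finset.mul_sum]; exact Finset.sum_congr rfl fun _ _ => by ring
      ext i
      simp only [Pi.smul_apply, smul_eq_mul, this, Pi.single_apply]
      split_ifs <;> ring)

theorem connBilin_apply (t w : κ → ℝ) (i : κ) :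
    connBilin a ε o t w i
      = w o * (a i * t i) - if i = o then ∑ j, ε j * a j * t j * w j else 0 := by
  simp [connBilin, LinearMap.toContinuousBilinearMap_apply, Pi.single_apply]

theorem connBilin_skew (ho : ε o = 1) (t v w : κ → ℝ) :
    ∑ i, ε i * connBilin a ε o t v i * w i + ∑ i, ε i * v i * connBilin a ε o t w i = 0 := by
  have e1 : ∀ i, ε i * connBilin a ε o t v i * w i = v o * (ε i * a i * t i * w i)
      - if i = o then ε i * (∑ j, ε j * a j * t j * v j) * w i else 0 := fun i => by
    rw [connBilin_apply]; split_ifs <;> ring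
  have e2 : ∀ i, ε i * v i * connBilin a ε o t w i = w o * (ε i * a i * t i * v i)
      - if i = o then ε i * (∑ j, ε j * a j * t j * w j) * v i else 0 := fun i => by
    rw [connBilin_apply]; split_ifs <;> ring
  simp only [e1, e2, Finset.sum_sub_distrib, Finset.sum_ite_eq', Finset.mem_univ, if_true, ho,
    ← Finset.mul_sum]
  ring

theorem curvature_apply (ha : a o = 0) (u t w : κ → ℝ) (i : κ) :
    (connBilin a ε o u (connBilin a ε o t w) - connBilin a ε o t (connBilin a ε o u w)
      - connBilin a ε o (connBilin a ε o u t - connBilin a ε o t u) w) i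
    = a i * ((∑ j, ε j * a j * u j * w j) * t i - (∑ j, ε j * a j * t j * w j) * u i)
      - w o * (a i ^ 2 * (t o * u i - u o * t i))
      + if i = o then ∑ j, ε j * a j ^ 2 * (t o * u j - u o * t j) * w j else 0 := by
  have hT : ∀ i, (connBilin a ε o u t - connBilin a ε o t u) i
      = a i * (t o * u i - u o * t i) := fun i => by
    simp only [Pi.sub_apply, connBilin_apply]
    have : ∑ j, ε j * a j * u j * t j = ∑ j, ε j * a j * t j * u j :=
      Finset.sum_congr rfl fun _ _ => by ring
    rw [this]; split_ifs <;> ring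
  have hS : ∀ u t : κ → ℝ, ∑ j, ε j * a j * u j * connBilin a ε o t w j
      = w o * ∑ j, ε j * a j ^ 2 * u j * t j := fun u t => by
    rw [Finset.mul_sum]
    refine Finset.sum_congr rfl fun j _ => ?_
    rw [connBilin_apply]
    split_ifs with h
    · subst h; rw [ha]; ring
    · ring
  have hU : ∑ j, ε j * a j ^ 2 * u j * t j = ∑ j, ε j * a j ^ 2 * t j * u j :=
    Finset.sum_congr rfl fun _ _ => by ring
  simp only [Pi.sub_apply]
  rw [connBilin_apply a ε o u (connBilin a ε o t w), connBilin_apply a ε o t (connBilin a ε o u w),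
    connBilin_apply a ε o (connBilin a ε o u t - _), hS, hS, hU]
  simp only [hT]
  have hV : ∑ j, ε j * a j * (a j * (t o * u j - u o * t j)) * w j
      = ∑ j, ε j * a j ^ 2 * (t o * u j - u o * t j) * w j :=
    Finset.sum_congr rfl fun _ _ => by ring
  rw [hV]
  simp only [connBilin_apply, ha, if_true]
  split_ifs <;> ring

/-- The Ricci form of the metric `∑ i, ε i e^{2 a i r} dx_i²` in the orthonormal frame. -/
def ricForm (t w : κ → ℝ) : ℝ :=
  -(∑ i, a i) * (∑ i, ε i * a i * t i * w i) - (∑ i, a i ^ 2) * (t o * w o)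

theorem sum_curvature_eq_ricForm {ι : Type*} [Fintype ι] (ha : a o = 0) (ho : ε o = 1)
    (hε : ∀ i, ε i = 1 ∨ ε i = -1)
    (ε' : ι → ℝ) (u : ι → κ → ℝ)
    (hu : ∀ i j : κ, ∑ k, ε' k * u k i * u k j = if i = j then ε i else 0) (t w : κ → ℝ) :
    ∑ k, ε' k * ∑ i, ε i * (connBilin a ε o (u k) (connBilin a ε o t w)
      - connBilin a ε o t (connBilin a ε o (u k) w)
      - connBilin a ε o (connBilin a ε o (u k) t - connBilin a ε o t (u k)) w) i * u k i
    = ricForm a ε o t w := by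
  have sq : ∀ i, ε i * ε i = 1 := fun i => by rcases hε i with h | h <;> simp [h]
  simp only [curvature_apply a ε o ha]
  have step : ∀ k, ε' k * ∑ i, ε i * (a i * ((∑ j, ε j * a j * u k j * w j) * t i
        - (∑ j, ε j * a j * t j * w j) * u k i) - w o * (a i ^ 2 * (t o * u k i - u k o * t i))
        + if i = o then ∑ j, ε j * a j ^ 2 * (t o * u k j - u k o * t j) * w j else 0) * u k i
      = ∑ i, ∑ j, ε i * a i * t i * ε j * a j * w j * (ε' k * u k j * u k i)
        - (∑ j, ε j * a j * t j * w j) * ∑ i, ε i * a i * (ε' k * u k i * u k i)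
        - w o * t o * ∑ i, ε i * a i ^ 2 * (ε' k * u k i * u k i)
        + w o * ∑ i, ε i * a i ^ 2 * t i * (ε' k * u k o * u k i)
        + t o * ∑ j, ε j * a j ^ 2 * w j * (ε' k * u k j * u k o)
        - (∑ j, ε j * a j ^ 2 * t j * w j) * (ε' k * u k o * u k o) := by
    intro k
    have h1 : ∀ i, ε i * (a i * ((∑ j, ε j * a j * u k j * w j) * t i
        - (∑ j, ε j * a j * t j * w j) * u k i) - w o * (a i ^ 2 * (t o * u k i - u k o * t i))
        + if i = o then ∑ j, ε j * a j ^ 2 * (t o * u k j - u k o * t j) * w j else 0) * u k i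
        = (∑ j, ε j * a j * u k j * w j) * (ε i * a i * t i * u k i)
          - (∑ j, ε j * a j * t j * w j) * (ε i * a i * (u k i * u k i))
          - w o * t o * (ε i * a i ^ 2 * (u k i * u k i))
          + w o * (ε i * a i ^ 2 * t i * (u k o * u k i))
          + if i = o then ε i * (∑ j, ε j * a j ^ 2 * (t o * u k j - u k o * t j) * w j) * u k i
            else 0 := fun i => by split_ifs <;> ring
    have h2 : ∑ j, ε j * a j ^ 2 * (t o * u k j - u k o * t j) * w j
        = t o * ∑ j, ε j * a j ^ 2 * w j * u k j - u k o * ∑ j, ε j * a j ^ 2 * t j * w j := by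
      rw [Finset.mul_sum, Finset.mul_sum, ← Finset.sum_sub_distrib]
      exact Finset.sum_congr rfl fun _ _ => by ring
    have h3 : ∑ i, ∑ j, ε i * a i * t i * ε j * a j * w j * (ε' k * u k j * u k i)
        = ε' k * ((∑ j, ε j * a j * u k j * w j) * ∑ i, ε i * a i * t i * u k i) := by
      rw [mul_comm (∑ j, ε j * a j * u k j * w j), Finset.sum_mul_sum, Finset.mul_sum]
      refine Finset.sum_congr rfl fun i _ => ?_
      rw [Finset.mul_sum]
      exact Finset.sum_congr rfl fun _ _ => by ring
    have p1 : ∀ (c : κ → ℝ) (i : κ) , ∑ j, c j * (ε' k * u k j * u k i)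
        = ε' k * ∑ j, c j * (u k j * u k i) := fun c i => by
      rw [Finset.mul_sum]; exact Finset.sum_congr rfl fun _ _ => by ring
    have p2 : ∀ (c : κ → ℝ), ∑ j, c j * (ε' k * u k j * u k j)
        = ε' k * ∑ j, c j * (u k j * u k j) := fun c => by
      rw [Finset.mul_sum]; exact Finset.sum_congr rfl fun _ _ => by ring
    have p3 : ∀ (c : κ → ℝ) , ∑ j, c j * (ε' k * u k o * u k j)
        = ε' k * ∑ j, c j * (u k o * u k j) := fun c => by
      rw [Finset.mul_sum]; exact Finset.sum_congr rfl fun _ _ => by ring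
    have p4 : ∀ (c : κ → ℝ) , ∑ j, c j * (u k j * u k o)
        = (∑ j, c j * u k j) * u k o := fun c => by
      rw [Finset.sum_mul]; exact Finset.sum_congr rfl fun _ _ => by ring
    rw [h3, p1, p2, p2, p3, p4, Finset.sum_congr rfl fun i _ => h1 i, h2]
    simp only [ Finset.sum_add_distrib, Finset.sum_sub_distrib, ← Finset.mul_sum,
      Finset.sum_ite_eq', Finset.mem_univ, if_true, ho]
    ring
  simp only [step, Finset.sum_add_distrib, Finset.sum_sub_distrib]
  have s1 : ∑ k, ∑ i, ∑ j, ε i * a i * t i * ε j * a j * w j * (ε' k * u k j * u k i)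
      = ∑ i, ε i * a i ^ 2 * t i * w i := by
    rw [Finset.sum_comm]
    refine Finset.sum_congr rfl fun i _ => ?_
    rw [Finset.sum_comm]
    simp only [← Finset.mul_sum, hu]
    simp only [mul_ite, mul_zero, Finset.sum_ite_eq', Finset.mem_univ, if_true]
    linear_combination (ε i * a i ^ 2 * t i * w i) * sq i
  have s2 : ∀ c : κ → ℝ, ∑ k, ∑ i, ε i * c i * (ε' k * u k i * u k i) = ∑ i, c i := fun c => by
    rw [Finset.sum_comm]
    refine Finset.sum_congr rfl fun i _ => ?_
    simp only [← Finset.mul_sum, hu, if_true]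
    linear_combination c i * sq i
  have s3 : ∑ k, ∑ i, ε i * a i ^ 2 * t i * (ε' k * u k o * u k i) = 0 := by
    rw [Finset.sum_comm]
    simp only [← Finset.mul_sum, hu]
    simp [ha]
  have s4 : ∑ k, ∑ i, ε i * a i ^ 2 * w i * (ε' k * u k i * u k o) = 0 := by
    rw [Finset.sum_comm]
    simp only [← Finset.mul_sum, hu]
    simp [ha]
  simp only [← Finset.mul_sum]
  rw [s1, s2 a, s2 fun i => a i ^ 2, s3, s4, hu, if_pos rfl, ho, ricForm]
  ring

end ConnectionForm

section Coframe

variable {E : Type*} [NormedAddCommGroup E] [NormedSpace ℝ E]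
  {κ : Type*} [Fintype κ] [DecidableEq κ] (a ε : κ → ℝ) (o : κ) (l : κ → E →L[ℝ] ℝ)

/-- The coframe `e^{a i r} dx_i`, where `x_i = l i` and `r = x_o`. -/
def coframe (x : E) : E →L[ℝ] (κ → ℝ) :=
  ContinuousLinearMap.pi fun i => Real.exp (a i * l o x) • l i

omit [Fintype κ] [DecidableEq κ] in
theorem coframe_apply (x v : E) (i : κ) :
    coframe a o l x v i = Real.exp (a i * l o x) * l i v := rfl

omit [DecidableEq κ] in
theorem contDiff_coframe {Y : E → E} (hY : ContDiff ℝ ∞ Y) :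
    ContDiff ℝ ∞ fun x => coframe a o l x (Y x) := by
  rw [contDiff_pi]
  intro i
  simp only [coframe_apply]
  fun_prop

omit [Fintype κ] [DecidableEq κ] in
theorem fderiv_coframe {Y : E → E} {x : E} (hY : DifferentiableAt ℝ Y x) (v : E) (i : κ) :
    fderiv ℝ (fun x => coframe a o l x (Y x)) x v i
      = a i * l o v * coframe a o l x (Y x) i + coframe a o l x (fderiv ℝ Y x v) i := by
  have h1 : ∀ i, HasFDerivAt (fun x => coframe a o l x (Y x) i)
      (Real.exp (a i * l o x) • (l i).comp (fderiv ℝ Y x)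
        + l i (Y x) • (Real.exp (a i * l o x) • (a i • l o))) x := fun i =>
    (((l o).hasFDerivAt.const_mul (a i)).exp).mul ((l i).hasFDerivAt.comp x hY.hasFDerivAt)
  rw [(hasFDerivAt_pi.2 h1).fderiv]
  simp only [coframe_apply, ContinuousLinearMap.pi_apply, add_apply,
    smul_apply, ContinuousLinearMap.comp_apply, smul_eq_mul]
  ring

/-- The covariant derivative, in the orthonormal frame, of the components `u` of a section. -/
def frameDeriv (X : E → E) (u : E → κ → ℝ) (x : E) : κ → ℝ :=
  fderiv ℝ u x (X x) + connBilin a ε o (coframe a o l x (X x)) (u x)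

theorem contDiff_frameDeriv {X : E → E} {u : E → κ → ℝ} (hX : ContDiff ℝ ∞ X)
    (hu : ContDiff ℝ ∞ u) : ContDiff ℝ ∞ (frameDeriv a ε o l X u) := by
  have h1 : ContDiff ℝ ∞ (fderiv ℝ u) := hu.fderiv_right (by simp)
  have h2 := contDiff_coframe a o l hX
  unfold frameDeriv
  fun_prop

theorem frameDeriv_torsion (ha : a o = 0) {X Y : E → E} {x : E} (hX : DifferentiableAt ℝ X x)
    (hY : DifferentiableAt ℝ Y x) :
    frameDeriv a ε o l X (fun x => coframe a o l x (Y x)) x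
      - frameDeriv a ε o l Y (fun x => coframe a o l x (X x)) x
      = coframe a o l x (fderiv ℝ Y x (X x) - fderiv ℝ X x (Y x)) := by
  ext i
  have hS : ∑ j, ε j * a j * coframe a o l x (X x) j * coframe a o l x (Y x) j
      = ∑ j, ε j * a j * coframe a o l x (Y x) j * coframe a o l x (X x) j :=
    Finset.sum_congr rfl fun _ _ => by ring
  have ho : ∀ v, coframe a o l x v o = l o v := fun v => by simp [coframe_apply, ha]
  simp only [frameDeriv, Pi.sub_apply, Pi.add_apply, fderiv_coframe a o l hX,
    fderiv_coframe a o l hY, connBilin_apply, hS, map_sub, ho]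
  ring

theorem frameDeriv_of_coframe_eq_zero (ha : a o = 0) {X Y : E → E} {x : E}
    (hX : DifferentiableAt ℝ X x) (hY : DifferentiableAt ℝ Y x)
    (h0 : ∀ x, coframe a o l x (X x) = 0) :
    frameDeriv a ε o l X (fun x => coframe a o l x (Y x)) x
      = coframe a o l x (fderiv ℝ Y x (X x) - fderiv ℝ X x (Y x)) := by
  rw [← frameDeriv_torsion a ε o l ha hX hY, funext h0]
  simp [frameDeriv]

theorem fderiv_frameDeriv {Y : E → E} {u : E → κ → ℝ} (hY : ContDiff ℝ ∞ Y)
    (hu : ContDiff ℝ ∞ u) (x v : E) :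
    fderiv ℝ (frameDeriv a ε o l Y u) x v
      = fderiv ℝ (fderiv ℝ u) x v (Y x) + fderiv ℝ u x (fderiv ℝ Y x v)
        + connBilin a ε o (coframe a o l x (Y x)) (fderiv ℝ u x v)
        + connBilin a ε o (fderiv ℝ (fun x => coframe a o l x (Y x)) x v) (u x) := by
  have d0 : DifferentiableAt ℝ u x := hu.contDiffAt.differentiableAt (by simp)
  have dY : DifferentiableAt ℝ Y x := hY.contDiffAt.differentiableAt (by simp)
  have d1 : DifferentiableAt ℝ (fderiv ℝ u) x :=
    (hu.fderiv_right (m := ∞) (by simp)).contDiffAt.differentiableAt (by simp)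
  have d2 : DifferentiableAt ℝ (fun x => coframe a o l x (Y x)) x :=
    (contDiff_coframe a o l hY).contDiffAt.differentiableAt (by simp)
  have h := (d1.hasFDerivAt.clm_apply dY.hasFDerivAt).add
    ((connBilin a ε o).hasFDerivAt_of_bilinear d2.hasFDerivAt d0.hasFDerivAt)
  have h' : HasFDerivAt (frameDeriv a ε o l Y u) _ x := h
  rw [h'.fderiv]
  simp
  abel

theorem frameDeriv_curvature (ha : a o = 0) {X Y : E → E} {u : E → κ → ℝ}
    (hX : ContDiff ℝ ∞ X) (hY : ContDiff ℝ ∞ Y) (hu : ContDiff ℝ ∞ u) (x : E) :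
    frameDeriv a ε o l X (frameDeriv a ε o l Y u) x
      - frameDeriv a ε o l Y (frameDeriv a ε o l X u) x
      - frameDeriv a ε o l (fun x => fderiv ℝ Y x (X x) - fderiv ℝ X x (Y x)) u x
    = connBilin a ε o (coframe a o l x (X x))
        (connBilin a ε o (coframe a o l x (Y x)) (u x))
      - connBilin a ε o (coframe a o l x (Y x))
        (connBilin a ε o (coframe a o l x (X x)) (u x))
      - connBilin a ε o (connBilin a ε o (coframe a o l x (X x)) (coframe a o l x (Y x))
        - connBilin a ε o (coframe a o l x (Y x)) (coframe a o l x (X x))) (u x) := by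
  have hs : fderiv ℝ (fderiv ℝ u) x (X x) (Y x) = fderiv ℝ (fderiv ℝ u) x (Y x) (X x) :=
    (hu.contDiffAt.isSymmSndFDerivAt (by
      rw [minSmoothness_of_isRCLikeNormedField]
      exact WithTop.coe_le_coe.2 (le_top : (2 : ℕ∞) ≤ ⊤))) _ _
  have ht := frameDeriv_torsion a ε o l ha (hX.contDiffAt.differentiableAt (by simp) (x := x))
    (hY.contDiffAt.differentiableAt (by simp))
  simp only [frameDeriv] at ht
  rw [frameDeriv, frameDeriv.eq_1 a ε o l Y (frameDeriv a ε o l X u), fderiv_frameDeriv a ε o l hY hu,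
    fderiv_frameDeriv a ε o l hX hu]
  simp only [frameDeriv]
  rw [← ht, hs]
  simp only [map_add, map_sub, add_apply, sub_apply]
  abel

theorem frameDeriv_add_left (X Y : E → E) (u : E → κ → ℝ) (x : E) :
    frameDeriv a ε o l (fun x => X x + Y x) u x
      = frameDeriv a ε o l X u x + frameDeriv a ε o l Y u x := by
  simp only [frameDeriv, map_add, add_apply]
  abel

theorem frameDeriv_smul_left (h : E → ℝ) (X : E → E) (u : E → κ → ℝ) (x : E) :
    frameDeriv a ε o l (fun x => h x • X x) u x = h x • frameDeriv a ε o l X u x := by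
  simp only [frameDeriv, map_smul, smul_apply, smul_add]

theorem frameDeriv_add_right (X : E → E) {u w : E → κ → ℝ} {x : E}
    (hu : DifferentiableAt ℝ u x) (hw : DifferentiableAt ℝ w x) :
    frameDeriv a ε o l X (fun x => u x + w x) x
      = frameDeriv a ε o l X u x + frameDeriv a ε o l X w x := by
  simp only [frameDeriv, fderiv_fun_add hu hw, map_add, add_apply]
  abel

theorem frameDeriv_leibniz (X : E → E) {h : E → ℝ} {u : E → κ → ℝ} {x : E}
    (hh : DifferentiableAt ℝ h x) (hu : DifferentiableAt ℝ u x) :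
    frameDeriv a ε o l X (fun x => h x • u x) x
      = h x • frameDeriv a ε o l X u x + fderiv ℝ h x (X x) • u x := by
  simp only [frameDeriv, fderiv_fun_smul hh hu, map_smul, add_apply, smul_apply, smul_add,
    ContinuousLinearMap.smulRight_apply]
  abel

theorem frameDeriv_metric (ho : ε o = 1) (X : E → E) {u w : E → κ → ℝ} {x : E}
    (hu : DifferentiableAt ℝ u x) (hw : DifferentiableAt ℝ w x) :
    fderiv ℝ (fun y => ∑ i, ε i * u y i * w y i) x (X x)
      = ∑ i, ε i * frameDeriv a ε o l X u x i * w x i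
        + ∑ i, ε i * u x i * frameDeriv a ε o l X w x i := by
  have hd := HasFDerivAt.fun_sum (u := Finset.univ) fun i _ =>
    ((hasFDerivAt_pi'.1 hu.hasFDerivAt i).const_mul (ε i)).mul (hasFDerivAt_pi'.1 hw.hasFDerivAt i)
  have hd' : HasFDerivAt (fun y => ∑ i, ε i * u y i * w y i) _ x := hd
  have hk := connBilin_skew a ε o ho (coframe a o l x (X x)) (u x) (w x)
  rw [← Finset.sum_add_distrib] at hk ⊢
  rw [hd'.fderiv, sum_apply, ← add_zero (Finset.sum _ _), ← hk, ← Finset.sum_add_distrib]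
  refine Finset.sum_congr rfl fun i _ => ?_
  simp only [frameDeriv, Pi.add_apply, add_apply, smul_apply, smul_eq_mul,
    ContinuousLinearMap.comp_apply, ContinuousLinearMap.proj_apply]
  ring

end Coframe

section Ricci

variable {E : Type*} [NormedAddCommGroup E] [NormedSpace ℝ E]
  {H : Type*} [TopologicalSpace H] (I : ModelWithCorners ℝ E H) [ChartedSpace H E]
  [IsManifold I ∞ E]
  {κ : Type*} [Fintype κ] [DecidableEq κ] (a ε : κ → ℝ) (o : κ) (l : κ → E →L[ℝ] ℝ)
  {V : E → Type*} [∀ x, AddCommGroup (V x)] [∀ x, Module ℝ (V x)]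
  (pr : ∀ x : E, TangentSpace I x →ₗ[ℝ] V x) (Φ : ∀ x, V x ≃ₗ[ℝ] (κ → ℝ))
  (σ : ∀ x, LinearMap.BilinForm ℝ (V x))

/-- The connection on `V` whose expression in the frame given by `Φ` is `frameDeriv`. -/
def frameConnection (X : ∀ x : E, TangentSpace I x) (ξ : ∀ x, V x) (x : E) : V x :=
  (Φ x).symm (frameDeriv a ε o l (fun x => X x) (fun x => Φ x (ξ x)) x)

omit [IsManifold I ∞ E] in
theorem apply_frameConnection (X : ∀ x : E, TangentSpace I x) (ξ : ∀ x, V x) :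
    (fun x => Φ x (frameConnection I a ε o l Φ X ξ x))
      = frameDeriv a ε o l (fun x => X x) (fun x => Φ x (ξ x)) :=
  funext fun x => (Φ x).apply_symm_apply _

variable (hI : IsFlatModel I)
  (s : (κ → ℝ) →L[ℝ] E) (hs : ∀ w i, l i (s w) = w i)
  (hpr : ∀ x (v : E), Φ x (pr x v) = coframe a o l x v)
include hI hpr

omit [DecidableEq κ] in
include hs in
theorem smoothSection_iff_contDiff (ξ : ∀ x, V x) :
    SmoothSection pr ξ ↔ ContDiff ℝ ∞ fun x => Φ x (ξ x) := by
  constructor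
  · rintro ⟨Y, hY, h⟩
    simp only [h]
    have := contDiff_coframe a o l ((hI.smoothField_iff).1 hY)
    exact (funext fun x => hpr x (Y x)) ▸ this
  · intro h
    refine ⟨fun x => (s fun i => Real.exp (-(a i * l o x)) * Φ x (ξ x) i : E),
      (hI.smoothField_iff).2 ?_, fun x => (Φ x).injective ?_⟩
    · refine s.contDiff.comp (contDiff_pi.2 fun i => ?_)
      have := contDiff_pi.1 h i
      fun_prop
    · refine (Eq.trans (hpr x _) (funext fun i => ?_)).symm
      rw [coframe_apply, hs, ← mul_assoc, ← Real.exp_add]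
      simp

include hs in
theorem isLeviCivita_frameConnection (ha : a o = 0) (ho : ε o = 1)
    (hσ : ∀ x u w, σ x u w = ∑ i, ε i * Φ x u i * Φ x w i) :
    IsLeviCivita pr σ (frameConnection I a ε o l Φ) := by
  have hsec := smoothSection_iff_contDiff I a o l pr Φ hI s hs hpr
  have hfld := fun {X} => hI.smoothField_iff (X := X)
  have dif : ∀ {u : E → κ → ℝ} (_ : ContDiff ℝ ∞ u) (x : E), DifferentiableAt ℝ u x :=
    fun hu x => hu.contDiffAt.differentiableAt (by simp)
  have happ := fun X ξ x => congrFun (apply_frameConnection I a ε o l Φ X ξ) x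
  refine { smooth := ?_, add_left := ?_, smul_left := ?_, add_right := ?_, leibniz := ?_,
           metric := ?_, torsion_free := ?_ }
  · intro X ξ hX hξ
    rw [hsec, apply_frameConnection]
    exact contDiff_frameDeriv a ε o l (hfld.1 hX) ((hsec ξ).1 hξ)
  · intro X Y ξ hX hY hξ
    funext x
    refine (Φ x).injective ?_
    rw [Pi.add_apply, map_add, happ, happ, happ]
    exact frameDeriv_add_left a ε o l (fun x => X x) (fun x => Y x) _ x
  · intro h X ξ hh hX hξ
    funext x
    refine (Φ x).injective ?_
    rw [map_smul, happ, happ]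
    exact frameDeriv_smul_left a ε o l h (fun x => X x) _ x
  · intro X ξ η hX hξ hη
    funext x
    refine (Φ x).injective ?_
    rw [Pi.add_apply, map_add, happ, happ, happ]
    simp only [Pi.add_apply, map_add]
    exact frameDeriv_add_right a ε o l _ (dif ((hsec ξ).1 hξ) x) (dif ((hsec η).1 hη) x)
  · intro h X ξ hh hX hξ
    funext x
    refine (Φ x).injective ?_
    have dh : DifferentiableAt ℝ h x :=
      ((hI.contMDiff_iff).1 hh).contDiffAt.differentiableAt (by simp)
    rw [map_add, map_smul, map_smul, happ, happ, hI.dirDeriv_eq]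
    simp only [map_smul]
    exact frameDeriv_leibniz a ε o l _ dh (dif ((hsec ξ).1 hξ) x)
  · intro X ξ η hX hξ hη x
    rw [hI.dirDeriv_eq, hσ, hσ, happ, happ]
    simp only [hσ]
    exact frameDeriv_metric a ε o l ho _ (dif ((hsec ξ).1 hξ) x) (dif ((hsec η).1 hη) x)
  · intro X Y hX hY x
    refine (Φ x).injective ?_
    have h1 : ∀ Z : ∀ x : E, TangentSpace I x,
        (fun x => Φ x (pr x (Z x))) = fun x => coframe a o l x (Z x) :=
      fun Z => funext fun x => hpr x (Z x)
    rw [map_sub, happ, happ, hI.mlieBracket_eq, hpr, h1, h1]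
    exact frameDeriv_torsion a ε o l ha ((hfld.1 hX).contDiffAt.differentiableAt (by simp))
      ((hfld.1 hY).contDiffAt.differentiableAt (by simp))

include hs in
theorem isRicci_of_frame (ha : a o = 0) (ho : ε o = 1) (hε : ∀ i, ε i = 1 ∨ ε i = -1)
    (hσ : ∀ x u w, σ x u w = ∑ i, ε i * Φ x u i * Φ x w i)
    (Ric : ∀ x : E, LinearMap.BilinForm ℝ (TangentSpace I x))
    (hRic : ∀ x (v w : E),
      Ric x v w = ricForm a ε o (coframe a o l x v) (coframe a o l x w)) :
    IsRicci pr σ Ric := by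
  refine ⟨frameConnection I a ε o l Φ,
    isLeviCivita_frameConnection I a ε o l pr Φ σ hI s hs hpr ha ho hσ, ?_⟩
  intro X Y x e ε' hX hY he hε' horth
  have hfld := fun {X} => hI.smoothField_iff (X := X)
  have hcard : Fintype.card (Fin (Module.finrank ℝ (V x))) = Fintype.card κ := by
    rw [Fintype.card_fin, (Φ x).finrank_eq, Module.finrank_pi]
  have horth' : ∀ k m, ∑ i, ε i * coframe a o l x (e k x) i * coframe a o l x (e m x) i
      = if k = m then ε' k else 0 := fun k m => by
    rw [← horth k m, hσ]
    exact Finset.sum_congr rfl fun i _ => by rw [← hpr x (e k x), ← hpr x (e m x)]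
  have hgram := sum_orthonormal_mul ε hcard hε ε' hε' (fun k => coframe a o l x (e k x)) horth'
  refine ((hRic x (X x) (Y x)).trans
    (sum_curvature_eq_ricForm a ε o ha ho hε ε' _ hgram _ _).symm).trans ?_
  have happ := fun X ξ x => congrFun (apply_frameConnection I a ε o l Φ X ξ) x
  have h1 : (fun x => Φ x (pr x (Y x))) = fun x => coframe a o l x (Y x) :=
    funext fun x => hpr x (Y x)
  refine Finset.sum_congr rfl fun k _ => ?_
  have h2 : (fun x => (VectorField.mlieBracket I (e k) X x : E))
      = fun x => fderiv ℝ (fun x => (X x : E)) x (e k x) - fderiv ℝ (fun x => (e k x : E)) x (X x) :=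
    funext fun x => hI.mlieBracket_eq _ _ x
  have h3 : Φ x (curvature (frameConnection I a ε o l Φ) (e k) X (fun y => pr y (Y y)) x)
      = frameDeriv a ε o l (e k) (frameDeriv a ε o l X (fun x => coframe a o l x (Y x))) x
        - frameDeriv a ε o l X (frameDeriv a ε o l (e k) (fun x => coframe a o l x (Y x))) x
        - frameDeriv a ε o l (fun x => fderiv ℝ (fun x => (X x : E)) x (e k x)
            - fderiv ℝ (fun x => (e k x : E)) x (X x)) (fun x => coframe a o l x (Y x)) x := by
    simp only [curvature, Pi.sub_apply, map_sub]
    rw [happ, happ, happ, apply_frameConnection, apply_frameConnection, h1, h2]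
  rw [hσ, h3, hpr x (e k x)]
  refine congrArg (ε' k * ·) (Finset.sum_congr rfl fun i _ =>
    congrArg (fun t : κ → ℝ => ε i * t i * _) ?_)
  exact (frameDeriv_curvature a ε o l ha (hfld.1 (he k)) (hfld.1 hX)
    (contDiff_coframe a o l (hfld.1 hY)) x).symm

end Ricci

section DiagonalMetric

variable {E : Type*} [NormedAddCommGroup E] [NormedSpace ℝ E]
  {κ : Type*} [Fintype κ] [DecidableEq κ] (a ε : κ → ℝ) (o : κ) (l : κ → E →L[ℝ] ℝ)

/-- The form `∑ i, ε i θ_i²`. -/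
def diagForm (θ : E →L[ℝ] (κ → ℝ)) : LinearMap.BilinForm ℝ E :=
  ∑ i, ε i • LinearMap.BilinForm.linMulLin
    ((LinearMap.proj i).comp θ.toLinearMap) ((LinearMap.proj i).comp θ.toLinearMap)

omit [DecidableEq κ] in
theorem diagForm_apply (θ : E →L[ℝ] (κ → ℝ)) (v w : E) :
    diagForm ε θ v w = ∑ i, ε i * θ v i * θ w i := by
  simp [diagForm, LinearMap.sum_apply, mul_assoc]

/-- The form `ricForm` evaluated on the coframe `θ`. -/
def ricBilin (θ : E →L[ℝ] (κ → ℝ)) : LinearMap.BilinForm ℝ E :=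
  (-(∑ i, a i)) • diagForm (fun i => ε i * a i) θ - (∑ i, a i ^ 2) •
    LinearMap.BilinForm.linMulLin
      ((LinearMap.proj o).comp θ.toLinearMap) ((LinearMap.proj o).comp θ.toLinearMap)

omit [DecidableEq κ] in
theorem ricBilin_apply (θ : E →L[ℝ] (κ → ℝ)) (v w : E) :
    ricBilin a ε o θ v w = ricForm a ε o (θ v) (θ w) := by
  simp [ricBilin, ricForm, diagForm_apply]

variable (s : (κ → ℝ) →L[ℝ] E) (hs : ∀ w i, l i (s w) = w i)

omit [Fintype κ] [DecidableEq κ] in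
include hs in
theorem coframe_surjective (x : E) : Surjective (coframe a o l x) := fun w =>
  ⟨s fun i => Real.exp (-(a i * l o x)) * w i, funext fun i => by
    rw [coframe_apply, hs, ← mul_assoc, ← Real.exp_add]; simp⟩

omit [Fintype κ] [DecidableEq κ] in
theorem coframe_eq_zero_iff (x v : E) : coframe a o l x v = 0 ↔ ∀ i, l i v = 0 := by
  simp [funext_iff, coframe_apply]

variable (hl : ∀ v, (∀ i, l i v = 0) → v = 0)

/-- The coframe as an isomorphism of the tangent space with `κ → ℝ`. -/
def coframeEquiv (x : E) : E ≃ₗ[ℝ] (κ → ℝ) :=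
  LinearEquiv.ofBijective (coframe a o l x).toLinearMap
    ⟨(injective_iff_map_eq_zero _).2 fun v hv => hl v ((coframe_eq_zero_iff a o l x v).1 hv),
      coframe_surjective a o l s hs x⟩

variable {H : Type*} [TopologicalSpace H] {I : ModelWithCorners ℝ E H} [ChartedSpace H E]
  [IsManifold I ∞ E] (hI : IsFlatModel I)
include hI

omit [DecidableEq κ] in
theorem smoothTensor_of_diagonal (g : ∀ x : E, LinearMap.BilinForm ℝ (TangentSpace I x))
    (hg : ∀ x (v w : E), g x v w = ∑ i, ε i * coframe a o l x v i * coframe a o l x w i) :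
    SmoothTensor g := by
  intro X Y hX hY
  rw [hI.contMDiff_iff]
  have h1 := contDiff_pi.1 (contDiff_coframe a o l (hI.smoothField_iff.1 hX))
  have h2 := contDiff_pi.1 (contDiff_coframe a o l (hI.smoothField_iff.1 hY))
  have : ContDiff ℝ ∞ fun x => ∑ i, ε i * coframe a o l x (X x) i * coframe a o l x (Y x) i :=
    ContDiff.sum fun i _ => (contDiff_const.mul (h1 i)).mul (h2 i)
  exact (funext fun x => hg x (X x) (Y x)) ▸ this

omit [DecidableEq κ] in
include hs hl in
theorem isSemiRiemannianMetric_of_diagonal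
    (g : ∀ x : E, LinearMap.BilinForm ℝ (TangentSpace I x)) (hε : ∀ i, ε i ≠ 0)
    (hg : ∀ x (v w : E), g x v w = ∑ i, ε i * coframe a o l x v i * coframe a o l x w i) :
    IsSemiRiemannianMetric g {i | ε i < 0}.ncard where
  symm x v w := by
    refine (hg x v w).trans (Eq.trans ?_ (hg x w v).symm)
    exact Finset.sum_congr rfl fun i _ => by ring
  smooth := smoothTensor_of_diagonal a ε o l hI g hg
  nondegenerate x := by
    classical
    exact nondegenerate_of_diagonal (V := E) (coframeEquiv a o l s hs hl x) ε hε (hg x)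
  index x := bilinIndex_of_diagonal (V := E) (coframeEquiv a o l s hs hl x) ε (hg x)

theorem lie_of_diagonal (ha : a o = 0) (ho : ε o = 1)
    (g : ∀ x : E, LinearMap.BilinForm ℝ (TangentSpace I x))
    (hg : ∀ x (v w : E), g x v w = ∑ i, ε i * coframe a o l x v i * coframe a o l x w i)
    {V X Y : ∀ x : E, TangentSpace I x} (hV : SmoothField I V) (hX : SmoothField I X)
    (hY : SmoothField I Y) (hV0 : ∀ x, coframe a o l x (V x) = 0) (x : E) :
    dirDeriv I V (fun y => g y (X y) (Y y)) x
      = g x (VectorField.mlieBracket I V X x) (Y x)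
        + g x (X x) (VectorField.mlieBracket I V Y x) := by
  have hV' := hI.smoothField_iff.1 hV
  have dif : ∀ {Z : E → E}, ContDiff ℝ ∞ Z → DifferentiableAt ℝ Z x := fun h =>
    h.contDiffAt.differentiableAt (by simp)
  have key : ∀ {Z : ∀ x : E, TangentSpace I x} (_ : SmoothField I Z),
      frameDeriv a ε o l (fun x => V x) (fun x => coframe a o l x (Z x)) x
        = coframe a o l x (VectorField.mlieBracket I V Z x) := by
    intro Z hZ
    rw [hI.mlieBracket_eq]
    exact frameDeriv_of_coframe_eq_zero a ε o l ha (dif hV') (dif (hI.smoothField_iff.1 hZ)) hV0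
  have dX : DifferentiableAt ℝ (fun x => coframe a o l x (X x)) x :=
    (contDiff_coframe a o l (hI.smoothField_iff.1 hX)).contDiffAt.differentiableAt (by simp)
  have dY : DifferentiableAt ℝ (fun x => coframe a o l x (Y x)) x :=
    (contDiff_coframe a o l (hI.smoothField_iff.1 hY)).contDiffAt.differentiableAt (by simp)
  have hm := frameDeriv_metric a ε o l ho (fun x => V x) dX dY
  rw [key hX, key hY] at hm
  rw [hI.dirDeriv_eq]
  refine Eq.trans ?_ (hm.trans (congrArg₂ (· + ·) (hg x _ _) (hg x _ _)).symm)
  rw [show (fun y => g y (X y) (Y y)) = _ from funext fun y => hg y (X y) (Y y)]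

end DiagonalMetric

section Product

variable (q p : ℕ)

/-- The foliation of `ℝ^q × ℝ^p` by the fibres of the projection to `ℝ^q`. -/
def fibreFoliation : Foliation ((𝓡 q).prod (𝓡 p))
    (EuclideanSpace ℝ (Fin q) × EuclideanSpace ℝ (Fin p)) q where
  ι := Unit
  U _ := univ
  isOpen_U _ := isOpen_univ
  cover _ := ⟨(), trivial⟩
  proj _ := Prod.fst
  smooth_proj _ := contMDiff_fst.contMDiffOn
  submersion _ x _ := by
    rw [mfderiv_fst]
    exact Prod.fst_surjective
  trans _ _ := id
  smooth_trans _ _ := contDiff_id.contDiffOn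
  trans_proj _ _ _ _ := rfl

theorem fibreFoliation_tangent (z : EuclideanSpace ℝ (Fin q) × EuclideanSpace ℝ (Fin p)) :
    (fibreFoliation q p).tangent z
      = LinearMap.ker (mfderiv ((𝓡 q).prod (𝓡 p)) (𝓡 q)
        (Prod.fst : EuclideanSpace ℝ (Fin q) × EuclideanSpace ℝ (Fin p) → _) z).toLinearMap := by
  simp [Foliation.tangent, fibreFoliation]
  rfl

variable {q p} in
theorem mem_fibreFoliation_tangent (z v : EuclideanSpace ℝ (Fin q) × EuclideanSpace ℝ (Fin p)) :
    (show TangentSpace ((𝓡 q).prod (𝓡 p)) z from v) ∈ (fibreFoliation q p).tangent z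
      ↔ v.1 = 0 := by
  rw [fibreFoliation_tangent, mfderiv_fst]
  exact LinearMap.mem_ker

/-- The coordinates of the base. -/
def baseCoord (i : Fin q) : EuclideanSpace ℝ (Fin q) →L[ℝ] ℝ := EuclideanSpace.proj i

/-- The coordinates of the base, as functions on the product. -/
def baseCoordLift (i : Fin q) : EuclideanSpace ℝ (Fin q) × EuclideanSpace ℝ (Fin p) →L[ℝ] ℝ :=
  (EuclideanSpace.proj i).comp (ContinuousLinearMap.fst ℝ _ _)

/-- The coordinates of the product. -/
def totalCoord : Fin q ⊕ Fin p →
    EuclideanSpace ℝ (Fin q) × EuclideanSpace ℝ (Fin p) →L[ℝ] ℝ :=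
  Sum.elim (baseCoordLift q p)
    fun j => (EuclideanSpace.proj j).comp (ContinuousLinearMap.snd ℝ _ _)

/-- The vector of the base with given coordinates. -/
def baseVec : (Fin q → ℝ) →L[ℝ] EuclideanSpace ℝ (Fin q) :=
  (EuclideanSpace.equiv (Fin q) ℝ).symm

theorem baseCoord_baseVec (w : Fin q → ℝ) (i : Fin q) : baseCoord q i (baseVec q w) = w i := rfl

theorem eq_zero_of_baseCoord (v : EuclideanSpace ℝ (Fin q)) (h : ∀ i, baseCoord q i v = 0) :
    v = 0 := PiLp.ext h

/-- The horizontal vector with given coordinates. -/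
def baseVecLift : (Fin q → ℝ) →L[ℝ] EuclideanSpace ℝ (Fin q) × EuclideanSpace ℝ (Fin p) :=
  (baseVec q).prod 0

theorem baseCoordLift_baseVecLift (w : Fin q → ℝ) (i : Fin q) :
    baseCoordLift q p i (baseVecLift q p w) = w i := rfl

/-- The vector of the product with given coordinates. -/
def totalVec : (Fin q ⊕ Fin p → ℝ) →L[ℝ]
    EuclideanSpace ℝ (Fin q) × EuclideanSpace ℝ (Fin p) :=
  ((baseVec q).comp (ContinuousLinearMap.pi fun i => ContinuousLinearMap.proj (Sum.inl i))).prod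
    ((baseVec p).comp (ContinuousLinearMap.pi fun i => ContinuousLinearMap.proj (Sum.inr i)))

theorem totalCoord_totalVec (w : Fin q ⊕ Fin p → ℝ) (i : Fin q ⊕ Fin p) :
    totalCoord q p i (totalVec q p w) = w i := by
  cases i <;> rfl

theorem eq_zero_of_totalCoord (v : EuclideanSpace ℝ (Fin q) × EuclideanSpace ℝ (Fin p))
    (h : ∀ i, totalCoord q p i v = 0) : v = 0 :=
  Prod.ext (PiLp.ext fun i => h (Sum.inl i)) (PiLp.ext fun i => h (Sum.inr i))

end Product

section Example

variable (q p : ℕ)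

/-- The signs of a Lorentzian orthonormal frame with timelike direction `τ`. -/
def lorentzSign {κ : Type*} [DecidableEq κ] (τ i : κ) : ℝ := if i = τ then -1 else 1

theorem lorentzSign_eq {κ : Type*} [DecidableEq κ] (τ i : κ) :
    lorentzSign τ i = 1 ∨ lorentzSign τ i = -1 := by
  unfold lorentzSign; split_ifs <;> simp

theorem lorentzSign_ne_zero {κ : Type*} [DecidableEq κ] (τ i : κ) : lorentzSign τ i ≠ 0 := by
  unfold lorentzSign; split_ifs <;> simp

theorem ncard_lorentzSign {κ : Type*} [DecidableEq κ] (τ : κ) :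
    {i | lorentzSign τ i < 0}.ncard = 1 := by
  have : {i | lorentzSign τ i < 0} = {τ} := by
    ext i
    simp only [lorentzSign, mem_ofPred_eq, mem_singleton_iff]
    split_ifs with h <;> simp [h]
  rw [this, ncard_singleton]

variable {q} (a : Fin q → ℝ) (o τ : Fin q) (m : ℝ)

/-- The Lorentzian metric `∑ i, ± e^{2 a i r} dx_i²` on `ℝ^q`, with `r = x_o`. -/
def baseMetric (b : EuclideanSpace ℝ (Fin q)) :
    LinearMap.BilinForm ℝ (TangentSpace (𝓡 q) b) :=
  diagForm (E := EuclideanSpace ℝ (Fin q)) (lorentzSign τ) (coframe a o (baseCoord q) b)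

/-- The warping function `e^{m r}`. -/
def warp (b : EuclideanSpace ℝ (Fin q)) : ℝ := Real.exp (m * baseCoord q o b)

/-- The flat metric of `ℝ^p`. -/
def fibreMetric [NeZero p] (y : EuclideanSpace ℝ (Fin p)) :
    LinearMap.BilinForm ℝ (TangentSpace (𝓡 p) y) :=
  diagForm (E := EuclideanSpace ℝ (Fin p)) (fun _ => 1)
    (coframe (fun _ => 0) 0 (baseCoord p) y)

/-- The basic form on `ℝ^q × ℝ^p` induced by `baseMetric`. -/
def transverseForm (z : EuclideanSpace ℝ (Fin q) × EuclideanSpace ℝ (Fin p)) :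
    LinearMap.BilinForm ℝ (TangentSpace ((𝓡 q).prod (𝓡 p)) z) :=
  diagForm (E := EuclideanSpace ℝ (Fin q) × EuclideanSpace ℝ (Fin p)) (lorentzSign τ)
    (coframe a o (baseCoordLift q p) z)

theorem transverseForm_apply (z v w : EuclideanSpace ℝ (Fin q) × EuclideanSpace ℝ (Fin p)) :
    transverseForm p a o τ z v w = ∑ i, lorentzSign τ i
      * coframe a o (baseCoordLift q p) z v i * coframe a o (baseCoordLift q p) z w i :=
  diagForm_apply (E := EuclideanSpace ℝ (Fin q) × EuclideanSpace ℝ (Fin p)) _ _ _ _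

/-- The exponents of the metric on the total space. -/
def totalExponent : Fin q ⊕ Fin p → ℝ := Sum.elim a fun _ => m

theorem lorentzSign_inl (i : Fin q) :
    lorentzSign (Sum.inl τ : Fin q ⊕ Fin p) (Sum.inl i) = lorentzSign τ i := by
  simp [lorentzSign]

theorem lorentzSign_inr (i : Fin p) :
    lorentzSign (Sum.inl τ : Fin q ⊕ Fin p) (Sum.inr i) = 1 := by
  simp [lorentzSign]

theorem warpedMetric_apply [NeZero p]
    (z v w : EuclideanSpace ℝ (Fin q) × EuclideanSpace ℝ (Fin p)) :
    warpedMetric (baseMetric a o τ) (warp o m) (fibreMetric p) z v w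
      = ∑ i, lorentzSign (Sum.inl τ) i
        * coframe (totalExponent p a m) (Sum.inl o) (totalCoord q p) z v i
        * coframe (totalExponent p a m) (Sum.inl o) (totalCoord q p) z w i := by
  rw [Fintype.sum_sum_type]
  simp only [lorentzSign_inl, lorentzSign_inr]
  rw [warpedMetric, mfderiv_fst, mfderiv_snd]
  refine congrArg₂ (fun s t : ℝ => s + t) (diagForm_apply (κ := Fin q)
    (E := EuclideanSpace ℝ (Fin q)) _ _ v.1 w.1) ?_
  refine (congrArg (fun t => warp o m z.1 ^ 2 * t)
    (diagForm_apply (κ := Fin p) (E := EuclideanSpace ℝ (Fin p)) _ _ v.2 w.2)).trans ?_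
  rw [Finset.mul_sum]
  refine Finset.sum_congr rfl fun j _ => ?_
  have e1 : ∀ u : EuclideanSpace ℝ (Fin q) × EuclideanSpace ℝ (Fin p),
      coframe (totalExponent p a m) (Sum.inl o) (totalCoord q p) z u (Sum.inr j)
        = warp o m z.1 * u.2 j := fun u => rfl
  have e2 : ∀ u : EuclideanSpace ℝ (Fin p),
      coframe (fun _ => 0) 0 (baseCoord p) z.2 u j = u j := fun u => by
    simp [coframe_apply, baseCoord]
  rw [e1, e1, e2, e2]
  ring

theorem coframe_lift_eq_zero_iff (z v : EuclideanSpace ℝ (Fin q) × EuclideanSpace ℝ (Fin p)) :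
    coframe a o (baseCoordLift q p) z v = 0
      ↔ (show TangentSpace ((𝓡 q).prod (𝓡 p)) z from v) ∈ (fibreFoliation q p).tangent z := by
  rw [mem_fibreFoliation_tangent, coframe_eq_zero_iff]
  exact ⟨fun h => PiLp.ext h, fun h i => congrArg (baseCoord q i) h⟩

/-- The lifted coframe of the base, as an isomorphism of the normal space with `ℝ^q`. -/
def normalEquiv (z : EuclideanSpace ℝ (Fin q) × EuclideanSpace ℝ (Fin p)) :
    (fibreFoliation q p).Normal z ≃ₗ[ℝ] (Fin q → ℝ) :=
  (Submodule.quotEquivOfEq _ (LinearMap.ker (show TangentSpace ((𝓡 q).prod (𝓡 p)) z →ₗ[ℝ] _ from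
      (coframe a o (baseCoordLift q p) z).toLinearMap))
    (Submodule.ext fun v => (coframe_lift_eq_zero_iff p a o z v).symm)).trans
  (LinearMap.quotKerEquivOfSurjective _
    (coframe_surjective a o _ (baseVecLift q p) (baseCoordLift_baseVecLift q p) z))

variable (ha : a o = 0) (hτ : o ≠ τ)

theorem lorentzSign_of_ne (hτ : o ≠ τ) : lorentzSign τ o = 1 := by simp [lorentzSign, hτ]

include ha hτ in
theorem transverseForm_isBasic : (fibreFoliation q p).IsBasic (transverseForm p a o τ) where
  left z v hv := by
    refine LinearMap.mem_ker.2 (LinearMap.ext fun w => ?_)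
    refine (transverseForm_apply p a o τ z v w).trans ?_
    rw [(coframe_lift_eq_zero_iff p a o z v).2 hv]
    simp
  right z v hv := by
    refine LinearMap.mem_ker.2 (LinearMap.ext fun w => ?_)
    refine (transverseForm_apply p a o τ z w v).trans ?_
    rw [(coframe_lift_eq_zero_iff p a o z v).2 hv]
    simp
  lie V X Y hV hX hY hV0 x :=
    lie_of_diagonal a (lorentzSign τ) o (baseCoordLift q p) isFlatModel_prod ha
      (lorentzSign_of_ne o τ hτ) _ (transverseForm_apply p a o τ) hV hX hY
      (fun z => (coframe_lift_eq_zero_iff p a o z (V z)).2 (hV0 z)) x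

theorem normalForm_apply (z : EuclideanSpace ℝ (Fin q) × EuclideanSpace ℝ (Fin p))
    (u w : (fibreFoliation q p).Normal z) :
    (transverseForm_isBasic p a o τ ha hτ).normalForm z u w
      = ∑ i, lorentzSign τ i * normalEquiv p a o z u i * normalEquiv p a o z w i := by
  induction u using Submodule.Quotient.induction_on with | _ u => ?_
  induction w using Submodule.Quotient.induction_on with | _ w => ?_
  exact transverseForm_apply p a o τ z u w

/-- The transverse metric on `ℝ^q × ℝ^p` induced by `baseMetric`. -/
def transverseMetric : (fibreFoliation q p).TransverseMetric 1 where
  form := transverseForm p a o τ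
  symm x v w := by
    refine (transverseForm_apply p a o τ x v w).trans
      (Eq.trans ?_ (transverseForm_apply p a o τ x w v).symm)
    exact Finset.sum_congr rfl fun i _ => by ring
  smooth := smoothTensor_of_diagonal a (lorentzSign τ) o (baseCoordLift q p) isFlatModel_prod _
    (transverseForm_apply p a o τ)
  basic := transverseForm_isBasic p a o τ ha hτ
  nondegenerate z := nondegenerate_of_diagonal (normalEquiv p a o z) _ (lorentzSign_ne_zero τ)
    (normalForm_apply p a o τ ha hτ z)
  index z := (bilinIndex_of_diagonal (normalEquiv p a o z) _
    (normalForm_apply p a o τ ha hτ z)).trans (ncard_lorentzSign τ)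

theorem warpedMetric_eq_add [NeZero p]
    (z v w : EuclideanSpace ℝ (Fin q) × EuclideanSpace ℝ (Fin p)) :
    warpedMetric (baseMetric a o τ) (warp o m) (fibreMetric p) z v w
      = transverseForm p a o τ z v w + warp o m z.1 ^ 2 * ∑ j, v.2 j * w.2 j := by
  rw [warpedMetric_apply, Fintype.sum_sum_type, transverseForm_apply, Finset.mul_sum]
  simp only [lorentzSign_inl, lorentzSign_inr]
  refine congrArg₂ (· + ·) rfl (Finset.sum_congr rfl fun j _ => ?_)
  have e1 : ∀ u : EuclideanSpace ℝ (Fin q) × EuclideanSpace ℝ (Fin p),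
      coframe (totalExponent p a m) (Sum.inl o) (totalCoord q p) z u (Sum.inr j)
        = warp o m z.1 * u.2 j := fun u => rfl
  rw [e1, e1]
  ring

theorem warp_pos (b : EuclideanSpace ℝ (Fin q)) : 0 < warp o m b := Real.exp_pos _

theorem mem_orthogonal_tangent_iff [NeZero p]
    (z v : EuclideanSpace ℝ (Fin q) × EuclideanSpace ℝ (Fin p)) :
    (show TangentSpace ((𝓡 q).prod (𝓡 p)) z from v) ∈
      (warpedMetric (baseMetric a o τ) (warp o m) (fibreMetric p) z).orthogonal
        ((fibreFoliation q p).tangent z) ↔ v.2 = 0 := by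
  have h0 : ∀ w : EuclideanSpace ℝ (Fin q) × EuclideanSpace ℝ (Fin p), w.1 = 0 →
      warpedMetric (baseMetric a o τ) (warp o m) (fibreMetric p) z w v
        = warp o m z.1 ^ 2 * ∑ j, w.2 j * v.2 j := fun w hw => by
    have := (coframe_lift_eq_zero_iff p a o z w).2 ((mem_fibreFoliation_tangent z w).2 hw)
    rw [warpedMetric_eq_add, transverseForm_apply, this]
    simp
  constructor
  · intro h
    refine PiLp.ext fun j => ?_
    have h1 : warpedMetric (baseMetric a o τ) (warp o m) (fibreMetric p) z
        ((0, EuclideanSpace.single j 1) : EuclideanSpace ℝ (Fin q) × EuclideanSpace ℝ (Fin p)) v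
          = 0 := h _ ((mem_fibreFoliation_tangent z _).2 rfl)
    rw [h0 _ rfl] at h1
    simpa [(warp_pos o m z.1).ne', Pi.single_apply] using h1
  · intro h w hw
    refine (h0 w ((mem_fibreFoliation_tangent z w).1 hw)).trans ?_
    rw [h]
    simp

theorem transverseForm_add_add [NeZero p] (z : EuclideanSpace ℝ (Fin q) × EuclideanSpace ℝ (Fin p))
    {s t v : EuclideanSpace ℝ (Fin q) × EuclideanSpace ℝ (Fin p)} (hs : s.1 = 0) (ht : t.1 = 0)
    (hv : v.2 = 0) (w : EuclideanSpace ℝ (Fin q) × EuclideanSpace ℝ (Fin p)) :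
    transverseForm p a o τ z (s + v) (t + w)
      = warpedMetric (baseMetric a o τ) (warp o m) (fibreMetric p) z v w := by
  have hs' := (coframe_lift_eq_zero_iff p a o z s).2 ((mem_fibreFoliation_tangent z s).2 hs)
  have ht' := (coframe_lift_eq_zero_iff p a o z t).2 ((mem_fibreFoliation_tangent z t).2 ht)
  rw [transverseForm_apply, warpedMetric_eq_add, transverseForm_apply, map_add, map_add, hs', ht',
    hv]
  simp

theorem isBundleLike_warpedMetric [NeZero p] :
    Foliation.IsBundleLike (warpedMetric (baseMetric a o τ) (warp o m) (fibreMetric p))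
      (transverseMetric p a o τ ha hτ) where
  adapted z := by
    constructor
    · rw [Submodule.disjoint_def]
      intro v h1 h2
      exact Prod.ext ((mem_fibreFoliation_tangent z v).1 h1)
        ((mem_orthogonal_tangent_iff p a o τ m z v).1 h2)
    · rw [codisjoint_iff, Submodule.eq_top_iff']
      intro v
      refine Submodule.mem_sup.2 ⟨(0, v.2), (mem_fibreFoliation_tangent z _).2 rfl, (v.1, 0),
        (mem_orthogonal_tangent_iff p a o τ m z _).2 rfl, ?_⟩
      exact Prod.ext (zero_add _) (add_zero _)
  associated z s hs t ht v hv w _ :=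
    transverseForm_add_add p a o τ m z ((mem_fibreFoliation_tangent z s).1 hs)
      ((mem_fibreFoliation_tangent z t).1 ht) ((mem_orthogonal_tangent_iff p a o τ m z v).1 hv) w

theorem timeOrientable_transverseMetric : (transverseMetric p a o τ ha hτ).TimeOrientable := by
  let T : EuclideanSpace ℝ (Fin q) × EuclideanSpace ℝ (Fin p) := (EuclideanSpace.single τ 1, 0)
  have hT : ∀ z, (show TangentSpace ((𝓡 q).prod (𝓡 p)) z from T) ∈
      (transverseMetric p a o τ ha hτ).timelike z := fun z => by
    have h := transverseForm_apply p a o τ z T T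
    have hc : ∀ i, coframe a o (baseCoordLift q p) z T i
        = if i = τ then Real.exp (a τ * baseCoordLift q p o z) else 0 := fun i => by
      have : baseCoordLift q p i T = if i = τ then 1 else 0 := by
        simp [baseCoordLift, T]
      rw [coframe_apply, this]
      split_ifs with h <;> simp [h]
    simp only [hc] at h
    change transverseForm p a o τ z T T < 0
    rw [h]
    simp [lorentzSign, Real.exp_pos]
  refine ⟨fun z => connectedComponentIn _ T, fun z => ⟨T, hT z, rfl⟩, fun z =>
    ⟨univ, isOpen_univ, trivial, fun _ => T, ?_, fun y _ => mem_connectedComponentIn (hT y)⟩⟩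
  have h : SmoothField ((𝓡 q).prod (𝓡 p)) fun _ => T :=
    isFlatModel_prod.smoothField_iff.2 contDiff_const
  exact ContMDiff.contMDiffOn h

theorem isWarpedLorentzFoliation_example [NeZero p] (hq : 2 ≤ q) :
    IsWarpedLorentzFoliation (baseMetric a o τ) (warp o m) (fibreMetric p) (fibreFoliation q p)
      (transverseMetric p a o τ ha hτ) where
  two_le := hq
  one_le := NeZero.one_le
  t2_B := inferInstance
  secondCountable_B := inferInstance
  connected_B := inferInstance
  t2_F := inferInstance
  secondCountable_F := inferInstance
  connected_F := inferInstance
  lorentzian_B := by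
    have := isSemiRiemannianMetric_of_diagonal a (lorentzSign τ) o (baseCoord q) (baseVec q)
      (baseCoord_baseVec q) (eq_zero_of_baseCoord q) isFlatModel_self (baseMetric a o τ)
      (lorentzSign_ne_zero τ) fun _ _ _ => diagForm_apply (E := EuclideanSpace ℝ (Fin q)) _ _ _ _
    rwa [ncard_lorentzSign] at this
  riemannian_F := by
    have := isSemiRiemannianMetric_of_diagonal _ (fun _ => 1) 0 (baseCoord p) (baseVec p)
      (baseCoord_baseVec p) (eq_zero_of_baseCoord p) isFlatModel_self (fibreMetric p)
      (fun _ => one_ne_zero) fun _ _ _ => diagForm_apply (E := EuclideanSpace ℝ (Fin p)) _ _ _ _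
    simpa [not_lt.2 (zero_le_one' ℝ)] using this
  smooth_f := by
    rw [contMDiff_iff_contDiff]
    exact Real.contDiff_exp.comp (contDiff_const.mul (baseCoord q o).contDiff)
  pos_f := warp_pos o m
  tangent_eq := fibreFoliation_tangent q p
  lorentzian := by
    have := isSemiRiemannianMetric_of_diagonal (totalExponent p a m) (lorentzSign (Sum.inl τ))
      (Sum.inl o) (totalCoord q p) (totalVec q p) (totalCoord_totalVec q p)
      (eq_zero_of_totalCoord q p) isFlatModel_prod
      (warpedMetric (baseMetric a o τ) (warp o m) (fibreMetric p))
      (lorentzSign_ne_zero _) (warpedMetric_apply p a o τ m)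
    rwa [ncard_lorentzSign] at this
  bundleLike := isBundleLike_warpedMetric p a o τ m ha hτ
  timeOrientable := timeOrientable_transverseMetric p a o τ ha hτ

/-- The Ricci tensor of the warped product. -/
def totalRicci (z : EuclideanSpace ℝ (Fin q) × EuclideanSpace ℝ (Fin p)) :
    LinearMap.BilinForm ℝ (TangentSpace ((𝓡 q).prod (𝓡 p)) z) :=
  ricBilin (E := EuclideanSpace ℝ (Fin q) × EuclideanSpace ℝ (Fin p)) (totalExponent p a m)
    (lorentzSign (Sum.inl τ)) (Sum.inl o)
    (coframe (totalExponent p a m) (Sum.inl o) (totalCoord q p) z)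

/-- The transverse Ricci tensor. -/
def transverseRicci (z : EuclideanSpace ℝ (Fin q) × EuclideanSpace ℝ (Fin p)) :
    LinearMap.BilinForm ℝ (TangentSpace ((𝓡 q).prod (𝓡 p)) z) :=
  ricBilin (E := EuclideanSpace ℝ (Fin q) × EuclideanSpace ℝ (Fin p)) a (lorentzSign τ) o
    (coframe a o (baseCoordLift q p) z)

include ha hτ in
theorem isRicciTensor_totalRicci [NeZero p] :
    IsRicciTensor (warpedMetric (baseMetric a o τ) (warp o m) (fibreMetric p))
      (totalRicci p a o τ m) :=
  isRicci_of_frame _ (totalExponent p a m) (lorentzSign (Sum.inl τ)) (Sum.inl o) (totalCoord q p)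
    _ (coframeEquiv _ _ _ (totalVec q p) (totalCoord_totalVec q p) (eq_zero_of_totalCoord q p)) _
    isFlatModel_prod (totalVec q p) (totalCoord_totalVec q p) (fun _ _ => rfl) ha
    ((lorentzSign_inl p τ o).trans (lorentzSign_of_ne o τ hτ)) (lorentzSign_eq _)
    (warpedMetric_apply p a o τ m) _ fun _ _ _ =>
      ricBilin_apply (E := EuclideanSpace ℝ (Fin q) × EuclideanSpace ℝ (Fin p)) _ _ _ _ _ _

theorem isTransverseRicciTensor_transverseRicci :
    (transverseMetric p a o τ ha hτ).IsTransverseRicciTensor (transverseRicci p a o τ) :=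
  isRicci_of_frame _ a (lorentzSign τ) o (baseCoordLift q p)
    _ (normalEquiv p a o) _ isFlatModel_prod (baseVecLift q p) (baseCoordLift_baseVecLift q p)
    (fun _ _ => rfl) ha (lorentzSign_of_ne o τ hτ) (lorentzSign_eq _)
    (normalForm_apply p a o τ ha hτ) _ fun _ _ _ =>
      ricBilin_apply (E := EuclideanSpace ℝ (Fin q) × EuclideanSpace ℝ (Fin p)) _ _ _ _ _ _

end Example

section Values

variable {q : ℕ} (p : ℕ) (a : Fin q → ℝ) (o τ : Fin q) (m : ℝ)

theorem warpedMetric_self [NeZero p]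
    (z v : EuclideanSpace ℝ (Fin q) × EuclideanSpace ℝ (Fin p)) :
    warpedMetric (baseMetric a o τ) (warp o m) (fibreMetric p) z v v
      = ∑ i, lorentzSign τ i * coframe a o (baseCoordLift q p) z v i ^ 2
        + ∑ j, (warp o m z.1 * v.2 j) ^ 2 := by
  rw [warpedMetric_eq_add, transverseForm_apply, Finset.mul_sum]
  exact congrArg₂ (· + ·) (Finset.sum_congr rfl fun _ _ => by ring)
    (Finset.sum_congr rfl fun _ _ => by ring)

theorem transverseRicci_self (z v : EuclideanSpace ℝ (Fin q) × EuclideanSpace ℝ (Fin p)) :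
    transverseRicci p a o τ z v v
      = -(∑ i, a i) * (∑ i, lorentzSign τ i * a i * coframe a o (baseCoordLift q p) z v i ^ 2)
        - (∑ i, a i ^ 2) * coframe a o (baseCoordLift q p) z v o ^ 2 := by
  refine (ricBilin_apply (E := EuclideanSpace ℝ (Fin q) × EuclideanSpace ℝ (Fin p))
    _ _ _ _ v v).trans ?_
  simp only [ricForm, mul_assoc, pow_two]

theorem totalRicci_self (z v : EuclideanSpace ℝ (Fin q) × EuclideanSpace ℝ (Fin p)) :
    totalRicci p a o τ m z v v
      = -(∑ i, a i + p * m)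
          * (∑ i, lorentzSign τ i * a i * coframe a o (baseCoordLift q p) z v i ^ 2
            + m * ∑ j, (warp o m z.1 * v.2 j) ^ 2)
        - (∑ i, a i ^ 2 + p * m ^ 2) * coframe a o (baseCoordLift q p) z v o ^ 2 := by
  refine (ricBilin_apply (E := EuclideanSpace ℝ (Fin q) × EuclideanSpace ℝ (Fin p))
    _ _ _ _ v v).trans ?_
  have e1 : ∀ i, coframe (totalExponent p a m) (Sum.inl o) (totalCoord q p) z v (Sum.inl i)
      = coframe a o (baseCoordLift q p) z v i := fun _ => rfl
  have e2 : ∀ j, coframe (totalExponent p a m) (Sum.inl o) (totalCoord q p) z v (Sum.inr j)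
      = warp o m z.1 * v.2 j := fun _ => rfl
  simp only [ricForm, Fintype.sum_sum_type, lorentzSign_inl, lorentzSign_inr, e1, e2]
  simp only [totalExponent, Sum.elim_inl, Sum.elim_inr, Finset.sum_const, Finset.card_univ,
    Fintype.card_fin, nsmul_eq_mul, one_mul, mul_assoc, pow_two, Finset.mul_sum]

end Values

end LorentzFoliation

end

theorem proposition6p2 :
    (∃ (q p : ℕ) (B : Type) (_ : TopologicalSpace B)
      (_ : ChartedSpace (EuclideanSpace ℝ (Fin q)) B) (_ : IsManifold (𝓡 q) ∞ B)
      (F : Type) (_ : TopologicalSpace F)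
      (_ : ChartedSpace (EuclideanSpace ℝ (Fin p)) F) (_ : IsManifold (𝓡 p) ∞ F)
      (gB : ∀ b : B, LinearMap.BilinForm ℝ (TangentSpace (𝓡 q) b)) (f : B → ℝ)
      (gF : ∀ y : F, LinearMap.BilinForm ℝ (TangentSpace (𝓡 p) y))
      (𝓕 : Foliation ((𝓡 q).prod (𝓡 p)) (B × F) q) (gT : 𝓕.TransverseMetric 1)
      (Ric RicT : ∀ z : B × F, LinearMap.BilinForm ℝ (TangentSpace ((𝓡 q).prod (𝓡 p)) z)),
      IsWarpedLorentzFoliation gB f gF 𝓕 gT ∧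
      IsRicciTensor (warpedMetric gB f gF) Ric ∧ gT.IsTransverseRicciTensor RicT ∧
      ∃ A C : ℝ, 0 < A ∧ 0 < C ∧
        ∀ (z : B × F) (v : TangentSpace ((𝓡 q).prod (𝓡 p)) z),
          warpedMetric gB f gF z v v = -1 → C ≤ Ric z v v ∧ RicT z v v ≤ -A) ∧
    (∃ (q p : ℕ) (B : Type) (_ : TopologicalSpace B)
      (_ : ChartedSpace (EuclideanSpace ℝ (Fin q)) B) (_ : IsManifold (𝓡 q) ∞ B)
      (F : Type) (_ : TopologicalSpace F)
      (_ : ChartedSpace (EuclideanSpace ℝ (Fin p)) F) (_ : IsManifold (𝓡 p) ∞ F)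
      (gB : ∀ b : B, LinearMap.BilinForm ℝ (TangentSpace (𝓡 q) b)) (f : B → ℝ)
      (gF : ∀ y : F, LinearMap.BilinForm ℝ (TangentSpace (𝓡 p) y))
      (𝓕 : Foliation ((𝓡 q).prod (𝓡 p)) (B × F) q) (gT : 𝓕.TransverseMetric 1)
      (Ric RicT : ∀ z : B × F, LinearMap.BilinForm ℝ (TangentSpace ((𝓡 q).prod (𝓡 p)) z)),
      IsWarpedLorentzFoliation gB f gF 𝓕 gT ∧
      IsRicciTensor (warpedMetric gB f gF) Ric ∧ gT.IsTransverseRicciTensor RicT ∧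
      ∃ C : ℝ, 0 < C ∧
        (∀ (z : B × F) (v : TangentSpace ((𝓡 q).prod (𝓡 p)) z),
          warpedMetric gB f gF z v v = -1 → C ≤ RicT z v v) ∧
        ∃ (z : B × F) (v₀ : TangentSpace ((𝓡 q).prod (𝓡 p)) z),
          warpedMetric gB f gF z v₀ v₀ < 0 ∧ Ric z v₀ v₀ < 0) := by
  constructor
  · let a : Fin 3 → ℝ := ![0, 2, -3]
    have ha : a 0 = 0 := rfl
    have hτ : (0 : Fin 3) ≠ 1 := by decide
    refine ⟨3, 15, EuclideanSpace ℝ (Fin 3), inferInstance, inferInstance, inferInstance,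
      EuclideanSpace ℝ (Fin 15), inferInstance, inferInstance, inferInstance,
      baseMetric a 0 1, warp 0 1, fibreMetric 15, fibreFoliation 3 15,
      transverseMetric 15 a 0 1 ha hτ, totalRicci 15 a 0 1 1, transverseRicci 15 a 0 1,
      isWarpedLorentzFoliation_example 15 a 0 1 1 ha hτ (by norm_num),
      isRicciTensor_totalRicci 15 a 0 1 1 ha hτ,
      isTransverseRicciTensor_transverseRicci 15 a 0 1 ha hτ, 2, 28, by norm_num, by norm_num,
      fun z v hv => ?_⟩
    have h1 := (warpedMetric_self 15 a 0 1 1 z v).symm.trans hv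
    have h2 := transverseRicci_self 15 a 0 1 z v
    have h3 := totalRicci_self 15 a 0 1 1 z v
    refine ⟨le_of_le_of_eq ?_ h3.symm, le_of_eq_of_le h2 ?_⟩
    all_goals
      have hS : 0 ≤ ∑ j, (warp 0 1 z.1 * v.2 j) ^ 2 := Finset.sum_nonneg fun _ _ => sq_nonneg _
      generalize ∑ j, (warp 0 1 z.1 * v.2 j) ^ 2 = S at h1 hS ⊢
      generalize coframe a 0 (baseCoordLift 3 15) z v = t at h1 ⊢
      simp only [Fin.sum_univ_three, lorentzSign, a, Fin.isValue, zero_ne_one, if_false, if_true,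
        Matrix.cons_val, Fin.reduceEq] at h1 ⊢
      norm_num at h1 ⊢
      nlinarith [sq_nonneg (t 0), sq_nonneg (t 1), sq_nonneg (t 2)]
  · let a : Fin 2 → ℝ := ![0, 1]
    have ha : a 0 = 0 := rfl
    have hτ : (0 : Fin 2) ≠ 1 := by decide
    refine ⟨2, 1, EuclideanSpace ℝ (Fin 2), inferInstance, inferInstance, inferInstance,
      EuclideanSpace ℝ (Fin 1), inferInstance, inferInstance, inferInstance,
      baseMetric a 0 1, warp 0 (-2), fibreMetric 1, fibreFoliation 2 1,
      transverseMetric 1 a 0 1 ha hτ, totalRicci 1 a 0 1 (-2), transverseRicci 1 a 0 1,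
      isWarpedLorentzFoliation_example 1 a 0 1 (-2) ha hτ le_rfl,
      isRicciTensor_totalRicci 1 a 0 1 (-2) ha hτ,
      isTransverseRicciTensor_transverseRicci 1 a 0 1 ha hτ, 1, one_pos, fun z v hv => ?_, ?_⟩
    · have h1 := (warpedMetric_self 1 a 0 1 (-2) z v).symm.trans hv
      refine le_of_le_of_eq ?_ (transverseRicci_self 1 a 0 1 z v).symm
      have hS : 0 ≤ ∑ j, (warp 0 (-2) z.1 * v.2 j) ^ 2 :=
        Finset.sum_nonneg fun _ _ => sq_nonneg _
      generalize ∑ j, (warp 0 (-2) z.1 * v.2 j) ^ 2 = S at h1 hS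
      generalize coframe a 0 (baseCoordLift 2 1) z v = t at h1 ⊢
      simp only [Fin.sum_univ_two, lorentzSign, a, Fin.isValue, zero_ne_one, if_false, if_true,
        Matrix.cons_val] at h1 ⊢
      norm_num at h1 ⊢
      linarith
    · let v₀ : EuclideanSpace ℝ (Fin 2) × EuclideanSpace ℝ (Fin 1) := (EuclideanSpace.single 1 1, 0)
      have e0 : coframe a 0 (baseCoordLift 2 1) 0 v₀ 0 = 0 := by
        simp [coframe_apply, baseCoordLift, v₀]
      have e1 : coframe a 0 (baseCoordLift 2 1) 0 v₀ 1 = 1 := by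
        simp [coframe_apply, baseCoordLift, v₀]
      have e2 : v₀.2 = 0 := rfl
      refine ⟨0, v₀, lt_of_eq_of_lt (warpedMetric_self 1 a 0 1 (-2) 0 v₀) ?_,
        lt_of_eq_of_lt (totalRicci_self 1 a 0 1 (-2) 0 v₀) ?_⟩
      · simp [Fin.sum_univ_two, e0, e1, e2, lorentzSign]
      · simp [Fin.sum_univ_two, e0, e1, e2, lorentzSign, a]
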